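/- Let $q=2^h$ with $h\ge 1$ odd, and for a finite-dimensional $\mathbb{F}_{q^6}$-vector space $V$ call an $\mathbb{F}_q$-subspace $U$ of $V$ *2-scattered* if $\dim_{\mathbb{F}_{q^6}}V\ge 3$, $\langle U\rangle_{\mathbb{F}_{q^6}}=V$ and $\dim_{\mathbb{F}_q}(U\cap W)\le 2$ for every $2$-dimensional $\mathbb{F}_{q^6}$-subspace $W$ of $V$; call it *maximum 2-scattered* if moreover no 2-scattered subspace of $V$ has larger $\mathbb{F}_q$-dimension. For $1\le s\le 5$ with $\gcd(s,6)=1$ and $\sigma:x\mapsto x^{q^s}$ put $$U_s=\{(x,y,x^{\sigma^2}+y^{\sigma},x^{\sigma}+y^{\sigma^3}) : x,y\in\mathbb{F}_{q^6},\ \mathrm{Tr}_{q^6/q^2}(x)=\mathrm{Tr}_{q^6/q^2}(y)=0\}\subseteq\mathbb{F}_{q^6}^4 .$$ Let $r\ge 3$ be an integer with $r\ne 5$. Then: 1. There is a maximum 2-scattered $\mathbb{F}_q$-subspace of $V=\mathbb{F}_{q^6}^r$. More precisely, $r=3a+4b$ for some integers $a,b\ge 0$; there is a maximum 2-scattered subspace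 of $\mathbb{F}_{q^6}^3$; and whenever $r=3a+4b$, $A_1,\dots,A_a$ are maximum 2-scattered subspaces of $\mathbb{F}_{q^6}^3$ and $U_{s_1},\dots,U_{s_b}$ are subspaces of $\mathbb{F}_{q^6}^4$ as above, the direct sum $A_1\oplus\dots\oplus A_a\oplus U_{s_1}\oplus\dots\oplus U_{s_b}$ is carried to a maximum 2-scattered subspace of $V$ by every $\mathbb{F}_{q^6}$-linear isomorphism $(\mathbb{F}_{q^6}^3)^a\oplus(\mathbb{F}_{q^6}^4)^b\cong V$. 2. Every maximum 2-scattered subspace $U$ of $\mathbb{F}_{q^6}^r$ has $\dim_{\mathbb{F}_q}U=2r$. Let $\mathcal{C}\subseteq\mathbb{F}_{q^6}^{2r}$ be a code associated with $U$, that is, the row space of an $r\times 2r$ matrix whose columns form an $\mathbb{F}_q$-basis of $U$ (such codes exist). Then $\mathcal{C}$ is a $[2r,r,4]_{q^6/q}$ rank-metric code (it has $\mathbb{F}_{q^6}$-dimension $r$ and minimum rank distance $4$), and it is an MRD code, that is, an $[n,k,d]_{q^m/q}$ code attaining the bound $mk\le\min\{m(n-d+1),n(m-d+1)\}$, here with $m=6$,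 $n=2r$, $k=r$, $d=4$. 3. For an $[n,k]_{q^6/q}$ code $\mathcal{C}$ associated with a system $U\subseteq\mathbb{F}_{q^6}^k$ of $\mathbb{F}_q$-dimension $n$ let $d_\rho(\mathcal{C})=n-\max\{\dim_{\mathbb{F}_q}(U\cap H): H\le\mathbb{F}_{q^6}^k,\ \dim_{\mathbb{F}_{q^6}}H=k-\rho\}$ be its $\rho$-generalized rank weight, and call $\mathcal{C}$ *$\rho$-MRD* ($\rho\ge1$) if $d_\rho(\mathcal{C})=n-k+\rho$. The codes $\mathcal{C}$ of part 2 satisfy $d_{r-2}(\mathcal{C})=2r-2$, so they are $(r-2)$-MRD; if $r\ge 4$, they are not $1$-MRD. -/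

import Mathlib

open Module

noncomputable section

namespace Scattered

section Subspaces

variable {F K V : Type*} [Field F] [Field K] [Algebra F K]
  [AddCommGroup V] [Module K V] [Module F V] [IsScalarTower F K V]

/-- The weight of the `K`-subspace `H` in the `F`-subspace `U`: the `F`-dimension of `H ∩ U`. -/
def weight (U : Submodule F V) (H : Submodule K V) : ℕ :=
  finrank F (H.restrictScalars F ⊓ U : Submodule F V)

variable (K)

/-- `U` is `h`-scattered, `0 < h ≤ r - 1` with `r = dim_K V`: `U` spans `V` over `K` and each
`h`-dimensional `K`-subspace of `V` has weight at most `h` in `U`. -/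
def IsScattered (h : ℕ) (U : Submodule F V) : Prop :=
  0 < h ∧ h < finrank K V ∧ Submodule.span K (U : Set V) = ⊤ ∧
    ∀ W : Submodule K V, finrank K W = h → weight U W ≤ h

/-- `U` is a maximum `h`-scattered subspace: `h`-scattered, of highest possible dimension. -/
def IsMaxScattered (h : ℕ) (U : Submodule F V) : Prop :=
  IsScattered K h U ∧
    ∀ U' : Submodule F V, IsScattered K h U' → finrank F U' ≤ finrank F U

end Subspaces

section Example

variable (F K : Type*) [Field F] [Fintype F] [Field K] [Algebra F K]

theorem pow_card_add (i : ℕ) (x y : K) :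
    (x + y) ^ Fintype.card F ^ i = x ^ Fintype.card F ^ i + y ^ Fintype.card F ^ i := by
  have key : ∀ z : K, ((FiniteField.frobeniusAlgHom F K) ^ i) z = z ^ Fintype.card F ^ i := by
    intro z
    rw [AlgHom.coe_pow, FiniteField.coe_frobeniusAlgHom, pow_iterate]
  rw [← key, ← key, ← key, map_add]

theorem smul_pow_card (i : ℕ) (c : F) (x : K) :
    (c • x) ^ Fintype.card F ^ i = c • x ^ Fintype.card F ^ i := by
  rw [smul_pow, FiniteField.pow_card_pow]

/-- With `q = |F|` and `K` of degree 6 over `F`, the trace of `x` over the subfield with `q ^ 2`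
elements is `x + x ^ q ^ 2 + x ^ q ^ 4`. For `σ : x ↦ x ^ q ^ s`, this is the `F`-subspace
`{(x, y, x ^ σ ^ 2 + y ^ σ, x ^ σ + y ^ σ ^ 3) : Tr x = Tr y = 0}` of `K ^ 4`. -/
def exampleFour (s : ℕ) : Submodule F (Fin 4 → K) where
  carrier := {v | ∃ x y : K,
    x + x ^ Fintype.card F ^ 2 + x ^ Fintype.card F ^ 4 = 0 ∧
    y + y ^ Fintype.card F ^ 2 + y ^ Fintype.card F ^ 4 = 0 ∧
    v = ![x, y, x ^ Fintype.card F ^ (2 * s) + y ^ Fintype.card F ^ s,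
      x ^ Fintype.card F ^ s + y ^ Fintype.card F ^ (3 * s)]}
  zero_mem' := by
    have hq : Fintype.card F ≠ 0 := Fintype.card_ne_zero
    refine ⟨0, 0, ?_, ?_, ?_⟩
    · simp [hq]
    · simp [hq]
    · ext i
      fin_cases i <;> simp [hq]
  add_mem' := by
    rintro _ _ ⟨x, y, hx, hy, rfl⟩ ⟨x', y', hx', hy', rfl⟩
    refine ⟨x + x', y + y', ?_, ?_, ?_⟩
    · rw [pow_card_add, pow_card_add]
      linear_combination hx + hx'
    · rw [pow_card_add, pow_card_add]
      linear_combination hy + hy'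
    · simp only [pow_card_add]
      ext i
      fin_cases i <;> simp <;> ring
  smul_mem' := by
    rintro c _ ⟨x, y, hx, hy, rfl⟩
    refine ⟨c • x, c • y, ?_, ?_, ?_⟩
    · rw [smul_pow_card, smul_pow_card, ← smul_add, ← smul_add, hx, smul_zero]
    · rw [smul_pow_card, smul_pow_card, ← smul_add, ← smul_add, hy, smul_zero]
    · simp only [smul_pow_card]
      ext i
      fin_cases i <;> simp

variable {F K}

/-- The direct sum of `F`-subspaces `A i` of `K ^ 3` and `B j` of `K ^ 4`, inside
`(K ^ 3) ^ a × (K ^ 4) ^ b`. -/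
def directSum {a b : ℕ} (A : Fin a → Submodule F (Fin 3 → K))
    (B : Fin b → Submodule F (Fin 4 → K)) :
    Submodule F ((Fin a → Fin 3 → K) × (Fin b → Fin 4 → K)) :=
  (Submodule.pi Set.univ A).prod (Submodule.pi Set.univ B)

end Example

section Codes

variable (F : Type*) {K : Type*} [Field F] [Field K] [Algebra F K]

/-- The rank weight of a vector: the dimension of the `F`-span of its entries. -/
def rankWeight {n : ℕ} (v : Fin n → K) : ℕ :=
  finrank F (Submodule.span F (Set.range v))

/-- `d` is the minimum distance of the linear rank-metric code `C`. -/
def IsMinDist {n : ℕ} (C : Submodule K (Fin n → K)) (d : ℕ) : Prop :=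
  IsLeast {w | ∃ v ∈ C, v ≠ 0 ∧ w = rankWeight F v} d

/-- `C` is a linear `[n, k, d]` code for the extension `K / F`. -/
def IsCode (n k d : ℕ) (C : Submodule K (Fin n → K)) : Prop :=
  finrank K C = k ∧ IsMinDist F C d

/-- `C` is a maximum rank distance code: with `m = [K : F]`, `k = dim_K C` and minimum distance
`d`, the bound `m k ≤ min {m (n - d + 1), n (m - d + 1)}` is attained. -/
def IsMRD {n : ℕ} (C : Submodule K (Fin n → K)) : Prop :=
  ∃ d : ℕ, IsMinDist F C d ∧
    ((finrank F K : ℤ) * finrank K C =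
      min ((finrank F K : ℤ) * (n - d + 1)) ((n : ℤ) * (finrank F K - d + 1)))

variable {F}

/-- The `ρ`-generalized rank weight of `U ⊆ K ^ k`, for `1 ≤ ρ ≤ k`: `dim_F U` minus the largest
weight in `U` of a `K`-subspace of codimension `ρ`. -/
def genRankWeight {k : ℕ} (U : Submodule F (Fin k → K)) (ρ : ℕ) : ℕ :=
  finrank F U -
    sSup {w | ∃ H : Submodule K (Fin k → K), finrank K H + ρ = k ∧ w = weight U H}

/-- `C` is a code associated with the system `U ⊆ K ^ k`: `U` spans `K ^ k` over `K` and `C` is the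
row space of a `k × n` matrix over `K` whose columns form an `F`-basis of `U`. -/
def IsAssociated {k n : ℕ} (U : Submodule F (Fin k → K)) (C : Submodule K (Fin n → K)) : Prop :=
  Submodule.span K (U : Set (Fin k → K)) = ⊤ ∧
    ∃ b : Basis (Fin n) F U,
      C = Submodule.span K (Set.range fun i : Fin k => fun j : Fin n => (b j : Fin k → K) i)

variable (F)

/-- `d` is the `ρ`-generalized rank weight of the (nondegenerate) code `C`, i.e. that of a system
with which `C` is associated. -/
def HasGenRankWeight {n : ℕ} (C : Submodule K (Fin n → K)) (ρ d : ℕ) : Prop :=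
  ∃ U : Submodule F (Fin (finrank K C) → K), IsAssociated U C ∧ genRankWeight U ρ = d

/-- `C` is `ρ`-MRD: `d_ρ(C) = n - k + ρ` with `k = dim_K C`, for a positive integer `ρ`. -/
def IsRhoMRD {n : ℕ} (ρ : ℕ) (C : Submodule K (Fin n → K)) : Prop :=
  0 < ρ ∧ HasGenRankWeight F C ρ (n - finrank K C + ρ)

end Codes

end Scattered

end

/-!
Write `m = [K : F] = 6`. A subspace `U` is `h`-scattered exactly when, for each `F`-subspace `T` of
`K` of dimension `h + 1`, the multiplication map `T ⊗ U → V` is injective (`TensorInjective`): both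
say that a tensor of rank at most `h + 1` is not killed. Comparing dimensions gives
`3 dim U ≤ 6 r` for two-scattered `U`, hence `dim U ≤ 2 r`.

If `dim U = 2 r`, injectivity is surjectivity, and the trace form turns it into a statement on
functionals: `U` is two-scattered if and only if `φ(U)` has `F`-dimension at least `4` for every
nonzero `K`-linear functional `φ` (`TensorInjective.minRank`, `MinRank.tensorInjective`). This
condition says that associated codes have minimum distance at least `4`; a Singleton-type bound
gives equality, and the parameters follow. It is also visibly inherited by direct sums, so that it
remains to find subspaces of dimension `6` in `K ^ 3` and of dimension `8` in `K ^ 4` which satisfy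
it. In `K ^ 3` the number of roots of a polynomial of degree `q ^ 2` shows it for
`{(x, x ^ q, x ^ q ^ 2)}`.

The heart of the matter is the example `U_s` in `K ^ 4` (`minRank_exampleFour`). Let
`σ : x ↦ x ^ q ^ s`, let `E` be the subfield fixed by `σ ^ 2`, `ω ∈ E` a primitive third root of
unity, and `θ` an eigenvector of `σ ^ 2` for `ω`. The elements of trace zero over `E` form
`θ E + σ(θ) E`. If a functional with coefficients `a, b, c, d` maps `U_s` into a `T` of dimension
`3`, extending scalars from `F` to `E` puts eight vectors into an `E`-subspace `S` of `K × K` of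
dimension at most `3` (`FunctionalVectors`). Let `M` be the `E`-span of `a, b, c, d`.

* If `dim M ≥ 2`, then `θ M + σ(θ) M = K`, so `S` is the graph of an `E`-linear map. Twisting it
  gives two `σ`-semilinear maps `ζ`, `η` on `M`, given on `a, b, c, d` by matrices over the field
  with two elements. They make `dim M` a multiple of `4`, which is absurd as `dim K = 3`
  (`SexticData.eq_zero_of_semilinear`). This uses that `y ^ 4 + y + 1` has no root in `E`.
* If `dim M = 1`, one may take `M = E`, and some quotient of norms is a root in `F` of
  `z ^ 2 + z + 1` (`SexticData.eq_zero_of_slope`).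

Both times the contradiction rests on `h` being odd.
-/

noncomputable section

namespace Scattered

/-! ### Scattered subspaces and the duality of Delsarte -/

section Generalities

variable {F K V : Type*} [Field F] [Field K] [Algebra F K]
  [AddCommGroup V] [Module K V] [Module F V] [IsScalarTower F K V]

theorem exists_between_finrank_eq {W : Type*} [AddCommGroup W] [Module F W]
    [FiniteDimensional F W] {N U : Submodule F W} (hNU : N ≤ U) {n : ℕ} (hN : finrank F N ≤ n)
    (hU : n ≤ finrank F U) : ∃ N' : Submodule F W, N ≤ N' ∧ N' ≤ U ∧ finrank F N' = n := by
  induction hk : n - finrank F N generalizing N with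
  | zero => exact ⟨N, le_rfl, hNU, by omega⟩
  | succ k ih =>
    have hlt : N < U := lt_of_le_of_ne hNU (by rintro rfl; omega)
    obtain ⟨x, hxU, hxN⟩ := SetLike.exists_of_lt hlt
    have h1 : finrank F (N ⊔ F ∙ x : Submodule F W) ≤ finrank F N + 1 :=
      (Submodule.finrank_add_le_finrank_add_finrank _ _).trans
        (Nat.add_le_add_left (by simpa using finrank_span_le_card (R := F) {x}) _)
    have h2 : finrank F N < finrank F (N ⊔ F ∙ x : Submodule F W) := by
      apply Submodule.finrank_lt_finrank_of_lt
      refine lt_of_le_of_ne le_sup_left fun h => hxN ?_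
      rw [h]
      exact Submodule.mem_sup_right (Submodule.mem_span_singleton_self x)
    obtain ⟨N', h3, h4, h5⟩ := ih (N := N ⊔ F ∙ x)
      (sup_le hNU ((Submodule.span_singleton_le_iff_mem _ _).2 hxU)) (by omega) (by omega)
    exact ⟨N', le_sup_left.trans h3, h4, h5⟩

/-- A family of `n` vectors of a subspace `U` with `dim U ≥ n` is contained in the span of a
linearly independent family of `n` vectors of `U`. -/
theorem exists_linearIndependent_coords {W : Type*} [AddCommGroup W] [Module F W]
    [FiniteDimensional F W] {U : Submodule F W} {n : ℕ} (hU : n ≤ finrank F U)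
    (u : Fin n → W) (hu : ∀ i, u i ∈ U) :
    ∃ (w : Fin n → W) (c : Fin n → Fin n → F), LinearIndependent F w ∧ (∀ j, w j ∈ U) ∧
      ∀ i, u i = ∑ j, c i j • w j := by
  have hN : finrank F (Submodule.span F (Set.range u)) ≤ n :=
    (finrank_range_le_card (R := F) u).trans_eq (Fintype.card_fin n)
  obtain ⟨N, h1, h2, h3⟩ := exists_between_finrank_eq
    (Submodule.span_le.2 (by rintro _ ⟨i, rfl⟩; exact hu i)) hN hU
  let b := finBasisOfFinrankEq F N h3
  refine ⟨fun j => b j, fun i j => b.repr ⟨u i, h1 (Submodule.subset_span ⟨i, rfl⟩)⟩ j,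
    b.linearIndependent.map' N.subtype N.ker_subtype, fun j => h2 (b j).2, fun i => ?_⟩
  have := congrArg N.subtype (b.sum_repr ⟨u i, h1 (Submodule.subset_span ⟨i, rfl⟩)⟩)
  rw [map_sum] at this
  exact this.symm

/-- The multiplication map `T ⊗ U → V` is injective for each `n`-dimensional `F`-subspace `T` of
`K`; the elements of `T ⊗ U` are written as sums over a basis `t` of `T`. -/
def TensorInjective (n : ℕ) (U : Submodule F V) : Prop :=
  ∀ t : Fin n → K, LinearIndependent F t → ∀ u : Fin n → V, (∀ i, u i ∈ U) →
    ∑ i, t i • u i = 0 → u = 0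

theorem finrank_of_tower (F K V : Type*) [Field F] [Field K] [Algebra F K]
    [AddCommGroup V] [Module K V] [Module F V] [IsScalarTower F K V] :
    finrank F V = finrank F K * finrank K V := (finrank_mul_finrank F K V).symm

/-- Linearly independent `(h + 1)`-tuples of an `h`-scattered subspace remain independent over
`K`. -/
theorem IsScattered.linearIndependent [FiniteDimensional F K] [FiniteDimensional K V]
    {h : ℕ} {U : Submodule F V} (hU : IsScattered K h U)
    {w : Fin (h + 1) → V} (hw : LinearIndependent F w) (hwU : ∀ i, w i ∈ U) :
    LinearIndependent K w := by
  have : FiniteDimensional F V := FiniteDimensional.trans F K V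
  by_contra hdep
  have h1 : finrank K (Submodule.span K (Set.range w)) ≤ h := by
    have h2 : Set.finrank K (Set.range w) ≤ h + 1 := by simpa using finrank_range_le_card (R := K) w
    have h3 : Set.finrank K (Set.range w) ≠ h + 1 := fun h4 =>
      hdep (linearIndependent_iff_card_eq_finrank_span.2 (by simpa using h4.symm))
    change Set.finrank K (Set.range w) ≤ h
    omega
  obtain ⟨W, hW1, -, hW2⟩ := exists_between_finrank_eq (U := (⊤ : Submodule K V)) le_top h1
    (by rw [finrank_top]; exact hU.2.1.le)
  have h3 := hU.2.2.2 W hW2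
  have h4 : Submodule.span F (Set.range w) ≤ W.restrictScalars F ⊓ U := by
    rw [Submodule.span_le]
    rintro _ ⟨i, rfl⟩
    exact ⟨hW1 (Submodule.subset_span ⟨i, rfl⟩), hwU i⟩
  have h5 := Submodule.finrank_mono h4
  rw [finrank_span_eq_card hw, Fintype.card_fin] at h5
  unfold weight at h3
  omega

theorem finrank_le_of_span_eq_top [FiniteDimensional F K] [FiniteDimensional K V]
    {U : Submodule F V}
    (hU : Submodule.span K (U : Set V) = ⊤) : finrank K V ≤ finrank F U := by
  have : FiniteDimensional F V := FiniteDimensional.trans F K V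
  let b := finBasis F U
  have h1 : Submodule.span K (Set.range fun i => (b i : V)) = ⊤ := by
    rw [eq_top_iff, ← hU, Submodule.span_le]
    intro u hu
    have := congrArg U.subtype (b.sum_repr ⟨u, hu⟩)
    rw [map_sum] at this
    change u ∈ _
    rw [show u = U.subtype ⟨u, hu⟩ from rfl, ← this]
    refine Submodule.sum_mem _ fun i _ => ?_
    rw [map_smul, ← algebraMap_smul K]
    exact Submodule.smul_mem _ _ (Submodule.subset_span ⟨i, rfl⟩)
  have h2 := finrank_range_le_card (R := K) fun i => (b i : V)
  rw [Set.finrank, h1, finrank_top, Fintype.card_fin] at h2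
  exact h2

/-- A relation `∑ t i • u i = 0` is rewritten in terms of a basis of the span of the `u i`, which
consists of at most `h + 1` vectors and stays independent over `K`. -/
theorem IsScattered.tensorInjective [FiniteDimensional F K] [FiniteDimensional K V]
    {h : ℕ} {U : Submodule F V} (hU : IsScattered K h U) :
    TensorInjective (K := K) (h + 1) U := by
  have : FiniteDimensional F V := FiniteDimensional.trans F K V
  intro t ht u hu h0
  obtain ⟨w, c, hw, hwU, hc⟩ := exists_linearIndependent_coords
    (hU.2.1.trans_le (finrank_le_of_span_eq_top hU.2.2.1)) u hu
  have hwK := hU.linearIndependent hw hwU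
  have h1 : ∑ j, (∑ i, c i j • t i) • w j = 0 := by
    rw [← h0]
    simp_rw [hc, Finset.sum_smul, Finset.smul_sum]
    rw [Finset.sum_comm]
    refine Finset.sum_congr rfl fun i _ => Finset.sum_congr rfl fun j _ => ?_
    rw [smul_assoc, smul_comm]
  have h2 := Fintype.linearIndependent_iff.1 hwK _ h1
  funext i
  rw [hc]
  refine Finset.sum_eq_zero fun j _ => ?_
  rw [Fintype.linearIndependent_iff.1 ht _ (h2 j) i, zero_smul]

/-- The counterpart of `IsScattered.tensorInjective`: a relation with coefficients in `K` is
rewritten in terms of a basis of the `F`-span of its coefficients. -/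
theorem TensorInjective.linearIndependent [FiniteDimensional F K]
    {n : ℕ} {U : Submodule F V} (hn : n ≤ finrank F K)
    (hU : TensorInjective (K := K) n U) {w : Fin n → V} (hw : LinearIndependent F w)
    (hwU : ∀ i, w i ∈ U) : LinearIndependent K w := by
  rw [Fintype.linearIndependent_iff]
  intro l hl i
  obtain ⟨t, c, ht, -, hc⟩ := exists_linearIndependent_coords (U := (⊤ : Submodule F K))
    (by rwa [finrank_top]) l (fun _ => trivial)
  have h1 : ∑ j, t j • ∑ i, c i j • w i = 0 := by
    rw [← hl]
    simp_rw [hc, Finset.sum_smul, Finset.smul_sum]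
    rw [Finset.sum_comm]
    refine Finset.sum_congr rfl fun i _ => Finset.sum_congr rfl fun j _ => ?_
    rw [smul_assoc, smul_comm]
  have h2 := hU t ht _ (fun j => U.sum_mem fun i _ => U.smul_mem _ (hwU i)) h1
  rw [hc]
  refine Finset.sum_eq_zero fun j _ => ?_
  rw [Fintype.linearIndependent_iff.1 hw _ (congrFun h2 j) i, zero_smul]

/-- The map `(u i) ↦ ∑ i, t i • u i`, which represents `T ⊗ U → V` when `t` is a basis of `T`. -/
def combMap {n : ℕ} (t : Fin n → K) (U : Submodule F V) : (Fin n → U) →ₗ[F] V where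
  toFun u := ∑ i, t i • (u i : V)
  map_add' u v := by simp [Finset.sum_add_distrib]
  map_smul' c u := by
    rw [RingHom.id_apply, Finset.smul_sum]
    exact Finset.sum_congr rfl fun i _ => smul_comm _ _ _

theorem tensorInjective_iff {n : ℕ} {U : Submodule F V} :
    TensorInjective (K := K) n U ↔
      ∀ t : Fin n → K, LinearIndependent F t → Function.Injective (combMap t U) := by
  refine forall_congr' fun t => forall_congr' fun ht => ?_
  rw [← LinearMap.ker_eq_bot, LinearMap.ker_eq_bot']
  constructor
  · intro h u hu
    have := h (fun i => u i) (fun i => (u i).2) hu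
    funext i
    exact Subtype.ext (congrFun this i)
  · intro h u huU hu
    have := h (fun i => ⟨u i, huU i⟩) hu
    funext i
    exact congrArg Subtype.val (congrFun this i)

theorem exists_linearIndependent_fin {F K : Type*} [Field F] [Field K] [Algebra F K]
    [FiniteDimensional F K] {n : ℕ} (hn : n ≤ finrank F K) :
    ∃ t : Fin n → K, LinearIndependent F t := by
  obtain ⟨w, -, hw, -⟩ := exists_linearIndependent_coords (U := (⊤ : Submodule F K))
    (by rwa [finrank_top]) (0 : Fin n → K) (fun _ => trivial)
  exact ⟨w, hw⟩

theorem TensorInjective.mul_finrank_le [FiniteDimensional F K] [FiniteDimensional K V]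
    {n : ℕ} {U : Submodule F V} (hn : n ≤ finrank F K)
    (hU : TensorInjective (K := K) n U) : n * finrank F U ≤ finrank F K * finrank K V := by
  have : FiniteDimensional F V := FiniteDimensional.trans F K V
  obtain ⟨t, ht⟩ := exists_linearIndependent_fin hn
  have := LinearMap.finrank_le_finrank_of_injective (tensorInjective_iff.1 hU t ht)
  simpa [finrank_pi_fintype, ← finrank_of_tower F K V] using this

/-- For `U` of the highest possible dimension the maps `T ⊗ U → V` are bijective. -/
theorem TensorInjective.surjective [FiniteDimensional F K] [FiniteDimensional K V]
    {n : ℕ} {U : Submodule F V}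
    (hU : TensorInjective (K := K) n U) (hdim : n * finrank F U = finrank F K * finrank K V)
    {t : Fin n → K} (ht : LinearIndependent F t) : Function.Surjective (combMap t U) := by
  have : FiniteDimensional F V := FiniteDimensional.trans F K V
  refine (LinearMap.injective_iff_surjective_of_finrank_eq_finrank ?_).1
    (tensorInjective_iff.1 hU t ht)
  rw [finrank_of_tower F K V, ← hdim]
  simp [finrank_pi_fintype]

theorem TensorInjective.span_eq_top [FiniteDimensional F K] [FiniteDimensional K V]
    {n : ℕ} {U : Submodule F V} (hn : n ≤ finrank F K)
    (hU : TensorInjective (K := K) n U) (hdim : n * finrank F U = finrank F K * finrank K V) :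
    Submodule.span K (U : Set V) = ⊤ := by
  obtain ⟨t, ht⟩ := exists_linearIndependent_fin hn
  rw [eq_top_iff]
  intro v _
  obtain ⟨u, rfl⟩ := hU.surjective hdim ht v
  change ∑ i, t i • (u i : V) ∈ _
  exact Submodule.sum_mem _ fun i _ => Submodule.smul_mem _ _ (Submodule.subset_span (u i).2)

theorem TensorInjective.isScattered [FiniteDimensional F K] [FiniteDimensional K V]
    {h : ℕ} {U : Submodule F V} (h0 : 0 < h)
    (hn : h + 1 ≤ finrank F K) (hV : h < finrank K V) (hU : TensorInjective (K := K) (h + 1) U)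
    (hspan : Submodule.span K (U : Set V) = ⊤) : IsScattered K h U := by
  have : FiniteDimensional F V := FiniteDimensional.trans F K V
  refine ⟨h0, hV, hspan, fun W hW => ?_⟩
  by_contra hlt
  push Not at hlt
  obtain ⟨w, -, hw, hwU, -⟩ := exists_linearIndependent_coords hlt 0 (fun _ => Submodule.zero_mem _)
  have hwK := hU.linearIndependent hn hw fun i => (hwU i).2
  have h1 : Submodule.span K (Set.range w) ≤ W := by
    rw [Submodule.span_le]
    rintro _ ⟨i, rfl⟩
    exact (hwU i).1
  have h2 := Submodule.finrank_mono h1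
  rw [finrank_span_eq_card hwK, Fintype.card_fin] at h2
  omega

/-- Every nonzero `K`-linear functional takes on `U` a set of values of `F`-dimension at least
`d`. -/
def MinRank (d : ℕ) (U : Submodule F V) : Prop :=
  ∀ φ : V →ₗ[K] K, φ ≠ 0 → d ≤ finrank F (U.map (φ.restrictScalars F))

theorem finrank_traceForm_orthogonal {F K : Type*} [Field F] [Field K] [Algebra F K]
    [FiniteDimensional F K] [Algebra.IsSeparable F K] (T : Submodule F K) :
    finrank F (LinearMap.BilinForm.orthogonal (Algebra.traceForm F K) T) =
      finrank F K - finrank F T :=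
  LinearMap.BilinForm.finrank_orthogonal (traceForm_nondegenerate F K) T

/-- The Delsarte-type duality, first half. If `φ(U)` were too small, its orthogonal complement for
the trace form would have a subspace `T` of dimension `n`, and as `T ⊗ U → V` is onto, the trace of
`φ` would vanish on all of `V`. -/
theorem TensorInjective.minRank [FiniteDimensional F K] [FiniteDimensional K V]
    [Algebra.IsSeparable F K]
    {n d : ℕ} {U : Submodule F V}
    (hnd : n + d = finrank F K + 1)
    (hU : TensorInjective (K := K) n U) (hdim : n * finrank F U = finrank F K * finrank K V) :
    MinRank (K := K) d U := by
  have : FiniteDimensional F V := FiniteDimensional.trans F K V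
  intro φ hφ
  by_contra hlt
  push Not at hlt
  set T := U.map (φ.restrictScalars F) with hT
  obtain ⟨t, -, ht, htT, -⟩ := exists_linearIndependent_coords (n := n)
    (U := LinearMap.BilinForm.orthogonal (Algebra.traceForm F K) T)
    (by rw [finrank_traceForm_orthogonal]; omega) 0 (fun _ => Submodule.zero_mem _)
  have h1 : ∀ v : V, Algebra.trace F K (φ v) = 0 := by
    intro v
    obtain ⟨u, rfl⟩ := hU.surjective hdim ht v
    change Algebra.trace F K (φ (∑ i, t i • (u i : V))) = 0
    rw [map_sum, map_sum]
    refine Finset.sum_eq_zero fun i _ => ?_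
    have := LinearMap.BilinForm.mem_orthogonal_iff.1 (htT i) (φ (u i))
      (Submodule.mem_map_of_mem (f := φ.restrictScalars F) (u i).2)
    rw [Algebra.traceForm_apply] at this
    rw [map_smul, smul_eq_mul, mul_comm, this]
  obtain ⟨x, hx⟩ := Algebra.trace_surjective F K 1
  obtain ⟨v, hv⟩ := LinearMap.surjective hφ x
  have := h1 v
  rw [hv, hx] at this
  exact one_ne_zero this

/-- An `F`-linear functional on a `K`-space is the trace of a `K`-linear one. -/
theorem exists_trace_comp_eq [FiniteDimensional F K] [Algebra.IsSeparable F K] (f : V →ₗ[F] F) :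
    ∃ φ : V →ₗ[K] K, ∀ v, Algebra.trace F K (φ v) = f v := by
  have hnd := traceForm_nondegenerate F K
  let D := (Algebra.traceForm F K).toDual hnd
  let g : V → (K →ₗ[F] F) := fun v => f ∘ₗ (LinearMap.toSpanSingleton K V v).restrictScalars F
  have hg : ∀ v x, Algebra.trace F K (D.symm (g v) * x) = f (x • v) := fun v x =>
    LinearMap.BilinForm.apply_toDual_symm_apply (hB := hnd) (g v) x
  have hext : ∀ y z : K, (∀ x, Algebra.trace F K (y * x) = Algebra.trace F K (z * x)) → y = z := by
    intro y z hyz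
    apply D.injective
    ext x
    exact hyz x
  refine ⟨{ toFun := fun v => D.symm (g v), map_add' := fun v w => ?_, map_smul' := fun c v => ?_ },
    fun v => ?_⟩
  · apply hext
    intro x
    rw [add_mul, map_add, hg, hg, hg, smul_add, map_add]
  · apply hext
    intro x
    rw [RingHom.id_apply, smul_eq_mul, hg, mul_comm c, mul_assoc, hg, mul_comm, smul_smul, mul_comm]
  · simpa using hg v 1

/-- The Delsarte-type duality, second half. If `T ⊗ U → V` were not onto, some functional
`Tr ∘ φ` would vanish on its image, so that `φ(U)` would be orthogonal to `T`. -/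
theorem MinRank.tensorInjective [FiniteDimensional F K] [FiniteDimensional K V]
    [Algebra.IsSeparable F K]
    {n d : ℕ} {U : Submodule F V}
    (hnd : n + d = finrank F K + 1)
    (hU : MinRank (K := K) d U) (hdim : n * finrank F U = finrank F K * finrank K V) :
    TensorInjective (K := K) n U := by
  have : FiniteDimensional F V := FiniteDimensional.trans F K V
  rw [tensorInjective_iff]
  intro t ht
  refine (LinearMap.injective_iff_surjective_of_finrank_eq_finrank ?_).2 ?_
  · rw [finrank_of_tower F K V, ← hdim]
    simp [finrank_pi_fintype]
  rw [← LinearMap.range_eq_top]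
  by_contra hne
  obtain ⟨f, hf0, hf⟩ := Submodule.exists_le_ker_of_lt_top _ (lt_top_iff_ne_top.2 hne)
  obtain ⟨φ, hφ⟩ := exists_trace_comp_eq (K := K) f
  have hφ0 : φ ≠ 0 := by
    rintro rfl
    apply hf0
    ext v
    simp [← hφ]
  have h1 := hU φ hφ0
  have h2 : U.map (φ.restrictScalars F) ≤
      LinearMap.BilinForm.orthogonal (Algebra.traceForm F K) (Submodule.span F (Set.range t)) := by
    rintro _ ⟨u, hu, rfl⟩
    rw [LinearMap.BilinForm.mem_orthogonal_iff]
    intro x hx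
    rw [Algebra.traceForm_apply]
    induction hx using Submodule.span_induction with
    | mem x hx =>
      obtain ⟨i, rfl⟩ := hx
      have h3 : combMap t U (Pi.single i ⟨u, hu⟩) ∈ LinearMap.ker f := hf ⟨_, rfl⟩
      have h4 : combMap t U (Pi.single i ⟨u, hu⟩) = t i • u := by
        change ∑ j, t j • ((Pi.single i (⟨u, hu⟩ : U) : Fin n → U) j : V) = _
        rw [Finset.sum_eq_single i]
        · simp
        · intro j _ hj
          simp [hj]
        · simp
      rw [h4, LinearMap.mem_ker, ← hφ, map_smul] at h3
      exact h3
    | zero => simp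
    | add x y _ _ hx hy => rw [add_mul, map_add, hx, hy, add_zero]
    | smul c x _ hx => rw [smul_mul_assoc, map_smul, hx, smul_zero]
  have h3 := Submodule.finrank_mono h2
  rw [finrank_traceForm_orthogonal, finrank_span_eq_card ht, Fintype.card_fin] at h3
  have h4 := ht.fintype_card_le_finrank
  rw [Fintype.card_fin] at h4
  omega

theorem MinRank.map_equiv {V' : Type*} [AddCommGroup V'] [Module K V'] [Module F V']
    [IsScalarTower F K V'] {d : ℕ} {U : Submodule F V} (hU : MinRank (K := K) d U)
    (e : V ≃ₗ[K] V') : MinRank (K := K) d (U.map (e.toLinearMap.restrictScalars F)) := by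
  intro φ hφ
  have h1 : φ ∘ₗ e.toLinearMap ≠ 0 := by
    intro h0
    apply hφ
    ext v
    simpa using LinearMap.congr_fun h0 (e.symm v)
  have h2 := hU _ h1
  rwa [← Submodule.map_comp]

theorem finrank_map_equiv {V' : Type*} [AddCommGroup V'] [Module K V'] [Module F V']
    [IsScalarTower F K V'] (U : Submodule F V) (e : V ≃ₗ[K] V') :
    finrank F (U.map (e.toLinearMap.restrictScalars F)) = finrank F U :=
  LinearEquiv.finrank_map_eq (e.restrictScalars F) U

/-- In a space of dimension `r` over an extension of degree `6`, the two-scattered subspaces of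
dimension `2 r` are maximum. -/
theorem isMaxScattered_of_minRank [FiniteDimensional F K] [FiniteDimensional K V]
    [Algebra.IsSeparable F K]
    (hK : finrank F K = 6)
    (hV : 3 ≤ finrank K V) {U : Submodule F V} (hU : MinRank (K := K) 4 U)
    (hdim : finrank F U = 2 * finrank K V) : IsMaxScattered K 2 U := by
  have h1 : 3 * finrank F U = finrank F K * finrank K V := by rw [hK, hdim]; ring
  have h2 := hU.tensorInjective (n := 3) (by rw [hK]) h1
  refine ⟨h2.isScattered two_pos (by omega) hV (h2.span_eq_top (by omega) h1), fun U' hU' => ?_⟩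
  have h3 := hU'.tensorInjective.mul_finrank_le (by omega)
  rw [← h1] at h3
  omega

theorem IsMaxScattered.finrank_eq {U₀ U : Submodule F V}
    (hU₀ : IsMaxScattered K 2 U₀) (hdim : finrank F U₀ = 2 * finrank K V)
    (hU : IsMaxScattered K 2 U) : finrank F U = 2 * finrank K V :=
  ((hU₀.2 U hU.1).antisymm (hU.2 U₀ hU₀.1)).trans hdim

theorem IsScattered.minRank [FiniteDimensional F K] [FiniteDimensional K V]
    [Algebra.IsSeparable F K]
    (hK : finrank F K = 6) {U : Submodule F V}
    (hU : IsScattered K 2 U) (hdim : finrank F U = 2 * finrank K V) : MinRank (K := K) 4 U :=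
  hU.tensorInjective.minRank (by rw [hK]) (by rw [hK, hdim]; ring)

end Generalities

/-! ### Associated codes and their generalized weights -/

section AssociatedCodes

variable {F K : Type*} [Field F] [Field K] [Algebra F K]

theorem functional_eq_sum {k : ℕ} (φ : Dual K (Fin k → K)) (v : Fin k → K) :
    φ v = ∑ i, φ (Pi.single i 1) * v i := by
  conv_lhs => rw [LinearMap.pi_apply_eq_sum_univ φ v]
  refine Finset.sum_congr rfl fun i _ => ?_
  rw [smul_eq_mul, mul_comm]
  congr 2
  funext j
  simp [Pi.single_apply, eq_comm]

/-- The codeword `(φ (b j))_j` of a functional `φ`. -/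
def encode {k n : ℕ} (b : Fin n → Fin k → K) : Dual K (Fin k → K) →ₗ[K] (Fin n → K) :=
  LinearMap.pi fun j => LinearMap.applyₗ (b j)

theorem encode_apply {k n : ℕ} (b : Fin n → Fin k → K) (φ : Dual K (Fin k → K)) (j : Fin n) :
    encode b φ j = φ (b j) := rfl

theorem span_rows_eq_range_encode {k n : ℕ} (b : Fin n → Fin k → K) :
    Submodule.span K (Set.range fun i : Fin k => fun j : Fin n => b j i) =
      LinearMap.range (encode b) := by
  apply le_antisymm
  · rw [Submodule.span_le]
    rintro _ ⟨i, rfl⟩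
    exact ⟨LinearMap.proj i, rfl⟩
  · rintro _ ⟨φ, rfl⟩
    have h1 : encode b φ = ∑ i, φ (Pi.single i 1) • fun j => b j i := by
      funext j
      rw [encode_apply, Finset.sum_apply, functional_eq_sum]
      rfl
    rw [h1]
    exact Submodule.sum_mem _ fun i _ => Submodule.smul_mem _ _ (Submodule.subset_span ⟨i, rfl⟩)

theorem span_range_basis {k n : ℕ} {U : Submodule F (Fin k → K)} (b : Basis (Fin n) F U) :
    Submodule.span F (Set.range fun j => (b j : Fin k → K)) = U := by
  have h1 := congrArg (Submodule.map U.subtype) b.span_eq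
  rwa [Submodule.map_span, ← Set.range_comp, Submodule.map_top, Submodule.range_subtype] at h1

theorem rankWeight_encode {k n : ℕ} {U : Submodule F (Fin k → K)} (b : Basis (Fin n) F U)
    (φ : Dual K (Fin k → K)) :
    rankWeight F (encode (fun j => (b j : Fin k → K)) φ) =
      finrank F (U.map (φ.restrictScalars F)) := by
  unfold rankWeight
  conv_rhs => rw [← span_range_basis b, Submodule.map_span, ← Set.range_comp]
  rfl

theorem encode_injective {k n : ℕ} {U : Submodule F (Fin k → K)} (b : Basis (Fin n) F U)
    (hU : Submodule.span K (U : Set (Fin k → K)) = ⊤) :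
    Function.Injective (encode fun j => (b j : Fin k → K)) := by
  rw [← LinearMap.ker_eq_bot, LinearMap.ker_eq_bot']
  intro φ hφ
  have h1 : U ≤ LinearMap.ker (φ.restrictScalars F) := by
    rw [← span_range_basis b, Submodule.span_le]
    rintro _ ⟨j, rfl⟩
    exact congrFun hφ j
  have h2 : (⊤ : Submodule K (Fin k → K)) ≤ LinearMap.ker φ := by
    rw [← hU, Submodule.span_le]
    exact h1
  ext1 i
  exact LinearMap.ext fun x => h2 (x := LinearMap.single K (fun _ => K) i x) trivial

theorem IsAssociated.finrank_eq {k n : ℕ} {U : Submodule F (Fin k → K)}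
    {C : Submodule K (Fin n → K)} (hC : IsAssociated U C) : finrank K C = k := by
  obtain ⟨hU, b, rfl⟩ := hC
  rw [span_rows_eq_range_encode, LinearMap.finrank_range_of_inj (encode_injective b hU),
    Subspace.dual_finrank_eq, finrank_fin_fun]

/-- The weights of the nonzero codewords are the dimensions of the images of `U` under the nonzero
functionals. -/
theorem IsAssociated.weights_eq {k n : ℕ} {U : Submodule F (Fin k → K)}
    {C : Submodule K (Fin n → K)} (hC : IsAssociated U C) :
    {w | ∃ v ∈ C, v ≠ 0 ∧ w = rankWeight F v} =
      {w | ∃ φ : Dual K (Fin k → K), φ ≠ 0 ∧ w = finrank F (U.map (φ.restrictScalars F))} := by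
  obtain ⟨hU, b, rfl⟩ := hC
  rw [span_rows_eq_range_encode]
  ext w
  constructor
  · rintro ⟨_, ⟨φ, rfl⟩, h0, rfl⟩
    exact ⟨φ, fun h => h0 (by rw [h, map_zero]), rankWeight_encode b φ⟩
  · rintro ⟨φ, h0, rfl⟩
    exact ⟨_, ⟨φ, rfl⟩, (map_ne_zero_iff _ (encode_injective b hU)).2 h0,
      (rankWeight_encode b φ).symm⟩

/-- A Singleton-type bound: composing with `K → K / T` for a `d`-dimensional `T` shows that some
nonzero functional maps `U` into `T`. -/
theorem exists_functional_finrank_map_le {V : Type*} [AddCommGroup V] [Module K V] [Module F V]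
    [IsScalarTower F K V] [FiniteDimensional F K] [FiniteDimensional K V] (U : Submodule F V)
    {d : ℕ} (hd : d ≤ finrank F K)
    (hlt : finrank F U * (finrank F K - d) < finrank F K * finrank K V) :
    ∃ φ : V →ₗ[K] K, φ ≠ 0 ∧ finrank F (U.map (φ.restrictScalars F)) ≤ d := by
  have : FiniteDimensional F V := FiniteDimensional.trans F K V
  obtain ⟨T, -, -, hT⟩ := exists_between_finrank_eq (F := F) (N := (⊥ : Submodule F K)) (U := ⊤)
    bot_le (n := d) (by simp) (by rwa [finrank_top])
  let b := finBasis F U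
  let g : (V →ₗ[K] K) →ₗ[F] (Fin (finrank F U) → K ⧸ T) :=
    { toFun := fun φ j => T.mkQ (φ (b j))
      map_add' := fun φ ψ => by funext j; simp
      map_smul' := fun c φ => by funext j; simp }
  have h1 : LinearMap.ker g ≠ ⊥ := by
    apply LinearMap.ker_ne_bot_of_finrank_lt
    rw [finrank_pi_fintype, Finset.sum_const, Finset.card_univ, Fintype.card_fin, smul_eq_mul,
      finrank_of_tower F K (V →ₗ[K] K), show finrank K (V →ₗ[K] K) = finrank K V from
      Subspace.dual_finrank_eq]
    have := Submodule.finrank_quotient_add_finrank T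
    rwa [show finrank F (K ⧸ T) = finrank F K - d by omega]
  obtain ⟨φ, hφ, h0⟩ := Submodule.exists_mem_ne_zero_of_ne_bot h1
  refine ⟨φ, h0, ?_⟩
  rw [← hT]
  apply Submodule.finrank_mono
  have h2 : ∀ j, φ (b j) ∈ T := fun j => by
    have := congrFun (LinearMap.mem_ker.1 hφ) j
    exact (Submodule.Quotient.mk_eq_zero T).1 this
  rintro _ ⟨u, hu, rfl⟩
  have h3 := congrArg U.subtype (b.sum_repr ⟨u, hu⟩)
  rw [map_sum] at h3
  have h4 : u = ∑ j, b.repr ⟨u, hu⟩ j • (b j : V) := h3.symm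
  rw [h4, map_sum]
  exact T.sum_mem fun j _ => by
    rw [map_smul]
    exact T.smul_mem _ (h2 j)

theorem weight_ker {V : Type*} [AddCommGroup V] [Module K V] [Module F V]
    [IsScalarTower F K V] [FiniteDimensional F V] (U : Submodule F V) (φ : V →ₗ[K] K) :
    finrank F (U.map (φ.restrictScalars F)) + weight U (LinearMap.ker φ) = finrank F U := by
  have h1 := LinearMap.finrank_range_add_finrank_ker ((φ.restrictScalars F).domRestrict U)
  rw [LinearMap.range_domRestrict, LinearMap.ker_domRestrict] at h1
  rw [← h1, weight, inf_comm, ← Submodule.map_comap_subtype, Submodule.finrank_map_subtype_eq]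
  rfl

theorem hasGenRankWeight_of_isAssociated {k n : ℕ} {U : Submodule F (Fin k → K)}
    {C : Submodule K (Fin n → K)} (hC : IsAssociated U C) (ρ : ℕ) :
    HasGenRankWeight F C ρ (genRankWeight U ρ) := by
  have hk := hC.finrank_eq
  subst hk
  exact ⟨U, hC, rfl⟩

theorem HasGenRankWeight.exists_system {k n ρ d : ℕ} {C : Submodule K (Fin n → K)}
    (hC : HasGenRankWeight F C ρ d) (hk : finrank K C = k) :
    ∃ U : Submodule F (Fin k → K), IsAssociated U C ∧ genRankWeight U ρ = d := by
  subst hk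
  exact hC

theorem bddAbove_weights [FiniteDimensional F K] {k : ℕ} (U : Submodule F (Fin k → K)) (ρ : ℕ) :
    BddAbove {w | ∃ H : Submodule K (Fin k → K), finrank K H + ρ = k ∧ w = weight U H} := by
  refine ⟨finrank F U, ?_⟩
  rintro _ ⟨H, -, rfl⟩
  exact Submodule.finrank_mono inf_le_right

theorem finrank_ker_functional {k : ℕ} {φ : Dual K (Fin k → K)} (hφ : φ ≠ 0) :
    finrank K (LinearMap.ker φ) + 1 = k := by
  simpa using Module.Dual.finrank_ker_add_one_of_ne_zero hφ

/-- The first generalized rank weight is at most the minimum distance. -/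
theorem genRankWeight_one_le [FiniteDimensional F K] {k : ℕ} (U : Submodule F (Fin k → K))
    {φ : Dual K (Fin k → K)} (hφ : φ ≠ 0) :
    genRankWeight U 1 ≤ finrank F (U.map (φ.restrictScalars F)) := by
  have : FiniteDimensional F (Fin k → K) := FiniteDimensional.trans F K _
  have h1 := weight_ker U φ
  have h2 : weight U (LinearMap.ker φ) ≤ _ :=
    le_csSup (bddAbove_weights U 1) ⟨_, finrank_ker_functional hφ, rfl⟩
  unfold genRankWeight
  omega

/-- In codimension `r - h` an `h`-scattered subspace has weight exactly `h`: it meets the `K`-span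
of `h` independent elements in their `F`-span. -/
theorem IsScattered.genRankWeight_eq [FiniteDimensional F K] {k h : ℕ}
    {U : Submodule F (Fin k → K)} (hU : IsScattered K h U) :
    genRankWeight U (k - h) = finrank F U - h := by
  have : FiniteDimensional F (Fin k → K) := FiniteDimensional.trans F K _
  have hhk : h < k := by simpa using hU.2.1
  have hle : h + 1 ≤ finrank F U := hU.2.1.trans_le (finrank_le_of_span_eq_top hU.2.2.1)
  obtain ⟨w, -, hw, hwU, -⟩ := exists_linearIndependent_coords hle 0
    (fun _ => Submodule.zero_mem _)
  have hwK := (hU.linearIndependent hw hwU).comp Fin.castSucc (Fin.castSucc_injective h)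
  have hwF := hw.comp Fin.castSucc (Fin.castSucc_injective h)
  set W := Submodule.span K (Set.range (w ∘ Fin.castSucc)) with hW
  have h1 : finrank K W = h := by rw [hW, finrank_span_eq_card hwK, Fintype.card_fin]
  have h2 : h ≤ weight U W := by
    have h3 : Submodule.span F (Set.range (w ∘ Fin.castSucc)) ≤ W.restrictScalars F ⊓ U := by
      rw [Submodule.span_le]
      rintro _ ⟨i, rfl⟩
      exact ⟨Submodule.subset_span ⟨i, rfl⟩, hwU _⟩
    have h4 := Submodule.finrank_mono h3
    rwa [finrank_span_eq_card hwF, Fintype.card_fin] at h4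
  unfold genRankWeight
  congr 1
  apply IsGreatest.csSup_eq
  refine ⟨⟨W, by omega, (h2.antisymm (hU.2.2.2 W h1))⟩, ?_⟩
  rintro _ ⟨H, hH, rfl⟩
  exact hU.2.2.2 H (by omega)

theorem exists_isAssociated {k n : ℕ} {U : Submodule F (Fin k → K)} [FiniteDimensional F U]
    (hU : Submodule.span K (U : Set (Fin k → K)) = ⊤) (hn : finrank F U = n) :
    ∃ C : Submodule K (Fin n → K), IsAssociated U C :=
  ⟨_, hU, finBasisOfFinrankEq F U hn, rfl⟩

/-- The codes associated with two-scattered subspaces of dimension `2 r` have minimum distance `4`: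
at least `4` by duality, at most `4` by the Singleton-type bound. -/
theorem IsScattered.isMinDist [FiniteDimensional F K] [Algebra.IsSeparable F K]
    (hK : finrank F K = 6) {r : ℕ} {U : Submodule F (Fin r → K)} (hU : IsScattered K 2 U)
    (hdim : finrank F U = 2 * r) {n : ℕ} {C : Submodule K (Fin n → K)} (hC : IsAssociated U C) :
    IsMinDist F C 4 := by
  have hr : 2 < r := by simpa using hU.2.1
  have h1 : MinRank (K := K) 4 U := hU.minRank hK (by simpa using hdim)
  obtain ⟨φ, h0, hφ⟩ := exists_functional_finrank_map_le (K := K) U (d := 4) (by omega)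
    (by rw [hK, hdim, finrank_fin_fun]; omega)
  rw [IsMinDist, hC.weights_eq]
  refine ⟨⟨φ, h0, (h1 φ h0).antisymm hφ⟩, ?_⟩
  rintro _ ⟨ψ, hψ, rfl⟩
  exact h1 ψ hψ

theorem IsScattered.isMRD [FiniteDimensional F K] [Algebra.IsSeparable F K]
    (hK : finrank F K = 6) {r : ℕ} {U : Submodule F (Fin r → K)} (hU : IsScattered K 2 U)
    (hdim : finrank F U = 2 * r) {C : Submodule K (Fin (2 * r) → K)} (hC : IsAssociated U C) :
    IsMRD F C := by
  have hr : 2 < r := by simpa using hU.2.1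
  refine ⟨4, hU.isMinDist hK hdim hC, ?_⟩
  rw [hC.finrank_eq, hK]
  push_cast
  rw [min_eq_right] <;> omega

theorem IsScattered.hasGenRankWeight [FiniteDimensional F K] {r : ℕ}
    {U : Submodule F (Fin r → K)} (hU : IsScattered K 2 U)
    (hdim : finrank F U = 2 * r) {C : Submodule K (Fin (2 * r) → K)} (hC : IsAssociated U C) :
    HasGenRankWeight F C (r - 2) (2 * r - 2) := by
  have h1 := hasGenRankWeight_of_isAssociated hC (r - 2)
  rwa [hU.genRankWeight_eq, hdim] at h1

theorem IsScattered.not_isRhoMRD_one [FiniteDimensional F K] [Algebra.IsSeparable F K]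
    (hK : finrank F K = 6) {r : ℕ} {U : Submodule F (Fin r → K)} (hU : IsScattered K 2 U)
    (hdim : finrank F U = 2 * r) {C : Submodule K (Fin (2 * r) → K)} (hC : IsAssociated U C)
    (hr3 : r ≠ 3) : ¬ IsRhoMRD F 1 C := by
  have hr : 2 < r := by simpa using hU.2.1
  rintro ⟨-, h1⟩
  obtain ⟨U', hU', h2⟩ := h1.exists_system hC.finrank_eq
  rw [hC.finrank_eq] at h2
  -- the system `U'` need not be `U`, but it yields the same set of weights of codewords
  have h3 := (hU.isMinDist hK hdim hC).1
  rw [hU'.weights_eq] at h3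
  obtain ⟨φ, h0, hφ⟩ := h3
  have h4 := genRankWeight_one_le U' h0
  omega

end AssociatedCodes

/-! ### Semilinear algebra over the quadratic subextension -/

section CubicExtension

variable {F K : Type*} [Field F] [Field K] [Algebra F K]

/-- The field-theoretic data for the examples in dimension four, where `K / F` has degree `6`,
the characteristic is `2` and `σ` generates the Galois group: `E` is the field fixed by `σ ^ 2`, `ω`
is a primitive third root of unity, and `θ` is an eigenvector of `σ ^ 2` for the eigenvalue `ω`. The
fields `no_cube_root` and `no_root` hold when `F` has `2 ^ h` elements with `h` odd. In
characteristic `2` the other primitive third root of unity, `ω ^ 2`, is written as `ω + 1`. -/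
structure SexticData (σ : K ≃ₐ[F] K) (E : IntermediateField F K) (ω θ : K) : Prop where
  mem_iff : ∀ x, x ∈ E ↔ σ (σ x) = x
  finrank_eq : finrank E K = 3
  two : (2 : K) = 0
  omega : ω ^ 2 + ω + 1 = 0
  map_omega : σ ω = ω + 1
  theta_ne : θ ≠ 0
  map_theta : σ (σ θ) = ω * θ
  no_cube_root : ∀ z, σ z = z → z ^ 2 + z + 1 ≠ 0
  no_root : ∀ y ∈ E, y ^ 4 + y + 1 ≠ 0


variable {σ : K ≃ₐ[F] K} {E : IntermediateField F K} {ω θ : K}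

theorem SexticData.map_mem (H : SexticData σ E ω θ) {x : K} (hx : x ∈ E) : σ x ∈ E :=
  (H.mem_iff _).2 (congrArg σ ((H.mem_iff _).1 hx))

theorem SexticData.omega_mem (H : SexticData σ E ω θ) : ω ∈ E := by
  rw [H.mem_iff, H.map_omega, map_add, map_one, H.map_omega]
  linear_combination H.two

/-- Half of the vectors of the functional with coefficients in `E` lie on a line of slope `μ` only
if the coefficients vanish. Here `w` is one of the two primitive third roots of unity. With `N` the
norm of `μ` to `F`, taking norms of the four equations gives
`(N ^ 2 + N + 1) ^ 2 = N (1 + N ^ 2)`, so `(1 + N ^ 2) / N` is a primitive third root of unity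
in `F`. -/
theorem SexticData.eq_zero_of_slope (H : SexticData σ E ω θ) {w a b c d μ : K}
    (hw : w ^ 2 + w + 1 = 0) (hσw : σ w = w + 1) (hc : c ∈ E) (hd : d ∈ E) (hμ : μ ∈ E) (ha : a ∈ E)
    (e1 : w * σ d = μ * (a + w * c)) (e2 : σ (a + (w + 1) * c) = μ * d)
    (e3 : w * σ (c + (w + 1) * d) = μ * b) (e4 : σ b = μ * (c + w * d)) :
    a = 0 ∧ b = 0 ∧ c = 0 ∧ d = 0 := by
  have h2 := H.two
  rw [H.mem_iff] at ha hc hd hμ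
  -- the equations `e2` and `e4` reduce the claim to `c = d = 0`
  have hfin : c = 0 → d = 0 → a = 0 ∧ b = 0 ∧ c = 0 ∧ d = 0 := by
    rintro rfl rfl
    simp only [mul_zero, add_zero, map_eq_zero] at e2 e4
    exact ⟨e2, e4, rfl, rfl⟩
  have e2' : a + (w + 1) * c = σ μ * σ d := by
    have := congrArg σ e2
    simp only [map_add, map_mul, map_one, ha, hc, hσw] at this
    grind
  have e3' : (w + 1) * (c + (w + 1) * d) = σ μ * σ b := by
    have := congrArg σ e3
    simp only [map_add, map_mul, map_one, hd, hc, hσw] at this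
    grind
  simp only [map_add, map_mul, map_one, hσw] at e2 e3
  obtain ⟨N, hN⟩ : ∃ N, N = μ * σ μ := ⟨_, rfl⟩
  have hσN : σ N = N := by rw [hN, map_mul, hμ, mul_comm]
  have i1 : w * (a + (w + 1) * c) = N * (a + w * c) := by
    rw [e2', hN]; linear_combination σ μ * e1
  have i2 : (w + 1) * (c + (w + 1) * d) = N * (c + w * d) := by
    rw [e3', hN]; linear_combination σ μ * e4
  by_cases hN0 : N = 0
  · have hμ0 : μ = 0 := by
      rcases mul_eq_zero.1 (hN.symm.trans hN0) with h | h
      · exact h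
      · simpa using h
    have hw0 : w ≠ 0 := by rintro rfl; simp at hw
    have hw1 : w + 1 ≠ 0 := by
      intro h
      apply hw0
      simpa [h] using (map_eq_zero σ).1 (hσw.trans h)
    have hd0 : d = 0 := by simpa [hμ0, hw0] using e1
    refine hfin ?_ hd0
    simpa [hN0, hd0, hw1] using i2
  have j1 : (a + (w + 1) * c) * (w + N) = c * N := by
    grind
  have j2 : σ (a + (w + 1) * c) * (w + 1 + N) = σ c * N := by
    have := congrArg σ j1
    rwa [map_mul, map_mul, map_add σ w N, hσw, hσN] at this
  have j3 : c * (w + 1 + N) = w * d * (1 + N) := by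
    grind
  have j4 : σ c * (w + N) = (w + 1) * σ d * (1 + N) := by
    have := congrArg σ j3
    simp only [map_add, map_mul, map_one, hσw, hσN] at this
    grind
  have hv : σ (a + (w + 1) * c) = μ * d := by
    simp only [map_add, map_mul, map_one, hσw]
    exact e2
  rw [hv] at j2
  rw [e2'] at j1
  have hprod : (w + N) * (w + 1 + N) = N ^ 2 + N + 1 := by grind
  have k1 : d * σ d * (N ^ 2 + N + 1) = c * σ c * N := by
    apply mul_left_cancel₀ hN0
    rw [← hprod]
    linear_combination μ * d * (w + 1 + N) * j1 + c * N * j2 +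
      d * σ d * (w + N) * (w + 1 + N) * hN
  have k2 : c * σ c * (N ^ 2 + N + 1) = d * σ d * (1 + N ^ 2) := by
    have : c * σ c * (N ^ 2 + N + 1) = w * (w + 1) * (d * σ d) * (1 + N) ^ 2 := by
      rw [← hprod]
      linear_combination (σ c * (w + N)) * j3 + w * d * (1 + N) * j4
    rw [this]
    linear_combination d * σ d * (1 + N) ^ 2 * hw - d * σ d * (1 + N + N ^ 2) * h2
  by_cases hd0 : d = 0
  · refine hfin ?_ hd0
    simpa [hd0, hN0] using k1
  exfalso
  have hnd : d * σ d ≠ 0 := mul_ne_zero hd0 (by simpa using hd0)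
  have k3 : (N ^ 2 + N + 1) ^ 2 = N * (1 + N ^ 2) := by
    apply mul_left_cancel₀ hnd
    linear_combination (N ^ 2 + N + 1) * k1 + N * k2
  refine H.no_cube_root ((1 + N ^ 2) / N) ?_ ?_
  · simp [map_div₀, hσN]
  · field_simp
    linear_combination k3

set_option linter.unusedSimpArgs false in
/-- On the span `M` of `a`, `b`, `c`, `d` the map `ζ ^ 2` satisfies `x ^ 2 + x + 1 = 0`, so `M` is
the sum of the eigenspaces of `ζ ^ 2` for `ω` and `ω + 1`, and `ζ` interchanges them. On the
eigenspace for `l`, the linear map `k = η ζ` satisfies `k ^ 2 = l ^ 2 (k + 1)`, a quadratic equation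
without root in `E`. For an eigenvector `m` the vectors `m`, `k m`, `ζ m`, `ζ k m` are therefore
independent, which is impossible in a space of dimension `3`. -/
theorem SexticData.eq_zero_of_semilinear (H : SexticData σ E ω θ) {a b c d : K} (ζ η : K →+ K)
    (hζ : ∀ e ∈ E, ∀ z, ζ (e * z) = σ e * ζ z) (hη : ∀ e ∈ E, ∀ z, η (e * z) = σ e * η z)
    (ζa : ζ a = a + c) (ζb : ζ b = d) (ζc : ζ c = b + c) (ζd : ζ d = a)
    (ηa : η a = a + b + d) (ηb : η b = c + d) (ηc : η c = a + c) (ηd : η d = c)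
    {m₀ : K} (hm₀ : m₀ ∈ Submodule.span E {a, b, c, d}) : m₀ = 0 := by
  have h2 := H.two
  set M := Submodule.span E {a, b, c, d} with hM
  have hind : ∀ {p : K → Prop}, p a → p b → p c → p d → (∀ x y, p x → p y → p (x + y)) →
      (∀ e ∈ E, ∀ x, p x → p (e * x)) → ∀ z ∈ M, p z := by
    intro p pa pb pc pd padd pmul z hz
    induction hz using Submodule.span_induction with
    | mem x hx =>
      rcases hx with rfl | rfl | rfl | rfl <;> assumption
    | zero => simpa using pmul 0 E.zero_mem a pa
    | add x y _ _ hx hy => exact padd x y hx hy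
    | smul e x _ hx => exact pmul e e.2 x hx
  have memE : ∀ e ∈ E, ∀ z ∈ M, e * z ∈ M := fun e he z hz => M.smul_mem ⟨e, he⟩ hz
  have hσE : ∀ e ∈ E, σ (σ e) = e := fun e he => (H.mem_iff e).1 he
  have am : a ∈ M := Submodule.subset_span (by simp)
  have bm : b ∈ M := Submodule.subset_span (by simp)
  have cm : c ∈ M := Submodule.subset_span (by simp)
  have dm : d ∈ M := Submodule.subset_span (by simp)
  have ζM : ∀ z ∈ M, ζ z ∈ M := by
    refine hind ?_ ?_ ?_ ?_ (fun x y hx hy => ?_) (fun e he x hx => ?_)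
    · rw [ζa]; exact add_mem am cm
    · rwa [ζb]
    · rw [ζc]; exact add_mem bm cm
    · rwa [ζd]
    · rw [map_add]; exact add_mem hx hy
    · rw [hζ e he]; exact memE _ (H.map_mem he) _ hx
  have ηM : ∀ z ∈ M, η z ∈ M := by
    refine hind ?_ ?_ ?_ ?_ (fun x y hx hy => ?_) (fun e he x hx => ?_)
    · rw [ηa]; exact add_mem (add_mem am bm) dm
    · rw [ηb]; exact add_mem cm dm
    · rw [ηc]; exact add_mem am cm
    · rwa [ηd]
    · rw [map_add]; exact add_mem hx hy
    · rw [hη e he]; exact memE _ (H.map_mem he) _ hx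
  have ζ4 : ∀ z ∈ M, ζ (ζ (ζ (ζ z))) + ζ (ζ z) + z = 0 := by
    refine hind ?_ ?_ ?_ ?_ (fun x y hx hy => ?_) (fun e he x hx => ?_)
    · simp only [ζa, ζb, ζc, ζd, map_add]; grind
    · simp only [ζa, ζb, ζc, ζd, map_add]; grind
    · simp only [ζa, ζb, ζc, ζd, map_add]; grind
    · simp only [ζa, ζb, ζc, ζd, map_add]; grind
    · simp only [map_add]; linear_combination hx + hy
    · have h3 := H.map_mem he
      rw [hζ e he, hζ _ h3, hσE e he, hζ e he, hζ _ h3, hσE e he]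
      linear_combination e * hx
  have ηη : ∀ z ∈ M, η (η z) = ζ (ζ z) := by
    refine hind ?_ ?_ ?_ ?_ (fun x y hx hy => ?_) (fun e he x hx => ?_)
    · simp only [ζa, ζb, ζc, ζd, ηa, ηb, ηc, ηd, map_add]; grind
    · simp only [ζa, ζb, ζc, ζd, ηa, ηb, ηc, ηd, map_add]; grind
    · simp only [ζa, ζb, ζc, ζd, ηa, ηb, ηc, ηd, map_add]; grind
    · simp only [ζa, ζb, ζc, ζd, ηa, ηb, ηc, ηd, map_add]
    · simp only [map_add, hx, hy]
    · have h3 := H.map_mem he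
      rw [hζ e he, hζ _ h3, hσE e he, hη e he, hη _ h3, hσE e he, hx]
  have ζη : ∀ z ∈ M, ζ (η z) = η (ζ z) + ζ (ζ z) + z := by
    refine hind ?_ ?_ ?_ ?_ (fun x y hx hy => ?_) (fun e he x hx => ?_)
    · simp only [ζa, ζb, ζc, ζd, ηa, ηb, ηc, ηd, map_add]; grind
    · simp only [ζa, ζb, ζc, ζd, ηa, ηb, ηc, ηd, map_add]; grind
    · simp only [ζa, ζb, ζc, ζd, ηa, ηb, ηc, ηd, map_add]; grind
    · simp only [ζa, ζb, ζc, ζd, ηa, ηb, ηc, ηd, map_add]; grind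
    · simp only [map_add, hx, hy]; ring
    · have h3 := H.map_mem he
      rw [hζ e he, hζ _ h3, hσE e he, hη e he, hη _ h3, hζ _ h3, hσE e he, hx]
      ring
  have ζinj : ∀ z ∈ M, ζ z = 0 → z = 0 := fun z hz h0 => by
    simpa [h0] using ζ4 z hz
  -- `ζ ^ 2` has no nonzero eigenvector in `M`
  have key : ∀ l ∈ E, l ^ 2 + l + 1 = 0 → σ l = l + 1 → ∀ m ∈ M, ζ (ζ m) = l * m → m = 0 := by
    intro l hl hl2 hσl m hm hgm
    by_contra hm0
    set k := η (ζ m) with hk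
    have hkM : k ∈ M := ηM _ (ζM _ hm)
    have hkk : η (ζ k) = (l + 1) * (k + m) := by
      have h3 := ζη _ (ζM _ hm)
      rw [← hk] at h3
      rw [h3, hgm, hζ l hl, map_add, map_add, ← hk, hη l hl, hη _ (H.map_mem hl) (η m),
        hη _ (H.map_mem hl) (ζ m), hσE l hl, ηη m hm, hgm, ← hk]
      linear_combination m * hl2 - m * (l + 1) * h2
    have hgk : ζ (ζ k) = l * k := by
      rw [← ηη k hkM, hk, ηη _ (ζM _ hm), hgm, hζ l hl, hη _ (H.map_mem hl), hσE l hl]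
    have hind2 : ∀ e₁ ∈ E, ∀ e₂ ∈ E, e₁ * m + e₂ * k = 0 → e₁ = 0 ∧ e₂ = 0 := by
      intro e₁ he₁ e₂ he₂ h0
      by_cases he : e₂ = 0
      · subst he
        simpa [hm0] using h0
      exfalso
      obtain ⟨κ, hκ⟩ : ∃ κ, κ = e₁ / e₂ := ⟨_, rfl⟩
      have hκE : κ ∈ E := hκ ▸ E.div_mem he₁ he₂
      have hkκ : k = κ * m := by
        rw [hκ]
        field_simp
        grind
      have h3 : η (ζ k) = κ * k := by
        rw [hkκ, hζ κ hκE, hη _ (H.map_mem hκE), hσE κ hκE, ← hk, hkκ]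
      rw [hkk, hkκ] at h3
      have h4 : (l + 1) * (κ + 1) = κ ^ 2 := by
        apply mul_right_cancel₀ hm0
        linear_combination h3
      -- `κ ^ 2 = l ^ 2 (κ + 1)` makes `y = l κ` a root of `y ^ 2 + y = l`
      refine H.no_root (l * κ) (E.mul_mem hl hκE) ?_
      grind
    have hli : LinearIndependent E ![m, k, ζ m, ζ k] := by
      rw [Fintype.linearIndependent_iff]
      intro e he
      rw [Fin.sum_univ_four] at he
      change (e 0 : K) * m + (e 1 : K) * k + (e 2 : K) * ζ m + (e 3 : K) * ζ k = 0 at he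
      have hE : ∀ i, (e i : K) ∈ E := fun i => (e i).2
      -- applying `ζ ^ 2` separates the components in the two eigenspaces
      have h3 := congrArg (fun z => ζ (ζ z)) he
      simp only [map_add, map_zero, hζ _ (hE _), hζ _ (H.map_mem (hE _)), hσE _ (hE _), hgm, hgk,
        hζ l hl, hσl] at h3
      have hA : (e 0 : K) * m + (e 1 : K) * k = 0 := by grind
      have hB : ζ (σ (e 2) * m + σ (e 3) * k) = 0 := by
        rw [map_add, hζ _ (H.map_mem (hE _)), hζ _ (H.map_mem (hE _)), hσE _ (hE _), hσE _ (hE _)]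
        linear_combination he - hA
      have hB' := ζinj _ (add_mem (memE _ (H.map_mem (hE _)) _ hm)
        (memE _ (H.map_mem (hE _)) _ hkM)) hB
      obtain ⟨h4, h5⟩ := hind2 _ (hE _) _ (hE _) hA
      obtain ⟨h6, h7⟩ := hind2 _ (H.map_mem (hE _)) _ (H.map_mem (hE _)) hB'
      rw [map_eq_zero] at h6 h7
      intro i
      apply Subtype.ext
      fin_cases i <;> assumption
    have : FiniteDimensional E K := Module.finite_of_finrank_eq_succ H.finrank_eq
    have h3 := hli.fintype_card_le_finrank
    rw [H.finrank_eq, Fintype.card_fin] at h3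
    omega
  have hωE := H.omega_mem
  have hω1 : ω + 1 ∈ E := E.add_mem hωE E.one_mem
  have hω := H.omega
  -- `ζ ^ 2` satisfies `x ^ 2 + x + 1 = (x + ω) (x + ω + 1)` on the span
  have h3 := key (ω + 1) hω1 (by grind) (by rw [map_add, map_one, H.map_omega])
    (ζ (ζ m₀) + ω * m₀) (add_mem (ζM _ (ζM _ hm₀)) (memE _ hωE _ hm₀)) (by
      have := ζ4 m₀ hm₀
      rw [map_add, map_add, hζ _ hωE, hζ _ (H.map_mem hωE), hσE _ hωE]
      grind)
  exact key ω hωE hω H.map_omega m₀ hm₀ (by grind)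

/-! ### Extension of scalars from `F` to `E` -/

/-- The `E`-span in `K × K` of the graph of `σ` over the `F`-subspace `T`: a copy of `E ⊗ T`. -/
def graphSpan (σ : K ≃ₐ[F] K) (E : IntermediateField F K) (T : Submodule F K) :
    Submodule E (K × K) :=
  Submodule.span E {p | ∃ t ∈ T, p = (t, σ t)}

theorem finrank_graphSpan_le [FiniteDimensional F K] (σ : K ≃ₐ[F] K) (E : IntermediateField F K)
    (T : Submodule F K) : finrank E (graphSpan σ E T) ≤ finrank F T := by
  let b := finBasis F T
  have h1 : graphSpan σ E T ≤
      Submodule.span E (Set.range fun i => ((b i : K), σ (b i))) := by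
    refine Submodule.span_le.2 ?_
    rintro _ ⟨t, ht, rfl⟩
    have h2 := congrArg T.subtype (b.sum_repr ⟨t, ht⟩)
    rw [map_sum] at h2
    have h3 : t = ∑ i, b.repr ⟨t, ht⟩ i • (b i : K) := h2.symm
    have h4 : (t, σ t) = ∑ i, algebraMap F E (b.repr ⟨t, ht⟩ i) • ((b i : K), σ (b i)) := by
      conv_lhs => rw [h3]
      rw [map_sum]
      refine Prod.ext ?_ ?_
      · simp only [Prod.fst_sum, Prod.smul_fst, algebraMap_smul]
      · simp only [Prod.snd_sum, Prod.smul_snd, algebraMap_smul, map_smul]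
    rw [SetLike.mem_coe, h4]
    exact Submodule.sum_mem _ fun i _ => Submodule.smul_mem _ _ (Submodule.subset_span ⟨i, rfl⟩)
  exact (Submodule.finrank_mono h1).trans
    ((finrank_range_le_card _).trans_eq (Fintype.card_fin _))

theorem mul_mem_prod {S : Submodule E (K × K)} {e x y : K} (he : e ∈ E) (h : (x, y) ∈ S) :
    (e * x, e * y) ∈ S :=
  S.smul_mem ⟨e, he⟩ h

/-- If `T` contains the image of `e ↦ p e + r σ(e)` on `E`, its graph span contains the two vectors
that give this map after extension of scalars. -/
theorem SexticData.pair_mem (H : SexticData σ E ω θ) {T : Submodule F K} {p r : K}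
    (h : ∀ e ∈ E, p * e + r * σ e ∈ T) :
    (p, σ r) ∈ graphSpan σ E T ∧ (r, σ p) ∈ graphSpan σ E T := by
  have h2 := H.two
  have hω := H.omega
  have h3 : (p + r, σ p + σ r) ∈ graphSpan σ E T := by
    have := h 1 E.one_mem
    simp only [map_one, mul_one] at this
    exact Submodule.subset_span ⟨_, this, by rw [map_add]⟩
  have h4 : (p * ω + r * (ω + 1), σ p * (ω + 1) + σ r * ω) ∈ graphSpan σ E T := by
    have := h ω H.omega_mem
    rw [H.map_omega] at this
    refine Submodule.subset_span ⟨_, this, Prod.ext rfl ?_⟩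
    simp only [map_add, map_mul, map_one, H.map_omega]
    linear_combination (-σ r) * h2
  constructor
  · have h5 := add_mem (mul_mem_prod (E.add_mem H.omega_mem E.one_mem) h3) h4
    convert h5 using 1
    refine Prod.ext ?_ ?_
    · simp only [Prod.fst_add]
      linear_combination (-(p * ω) - r * (ω + 1)) * h2
    · simp only [Prod.snd_add]
      linear_combination (-(σ p * (ω + 1)) - σ r * ω) * h2
  · have h5 := add_mem (mul_mem_prod H.omega_mem h3) h4
    convert h5 using 1
    refine Prod.ext ?_ ?_
    · simp only [Prod.fst_add]
      linear_combination (-(p * ω) - r * ω) * h2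
    · simp only [Prod.snd_add]
      linear_combination (-(σ p * ω) - σ r * ω) * h2

/-- The subspace `S` of `K × K` contains the eight vectors that describe the functional with
coefficients `a, b, c, d` on the example in dimension four. -/
structure FunctionalVectors (σ : K ≃ₐ[F] K) (ω θ a b c d : K) (S : Submodule E (K × K)) : Prop where
  x₁ : (θ * (a + ω * c), θ * (ω * σ d)) ∈ S
  x₂ : (θ * d, θ * σ (a + (ω + 1) * c)) ∈ S
  x₃ : (θ * b, θ * (ω * σ (c + (ω + 1) * d))) ∈ S
  x₄ : (θ * (c + ω * d), θ * σ b) ∈ S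
  y₁ : (σ θ * (a + (ω + 1) * c), σ θ * ((ω + 1) * σ d)) ∈ S
  y₂ : (σ θ * d, σ θ * σ (a + ω * c)) ∈ S
  y₃ : (σ θ * b, σ θ * ((ω + 1) * σ (c + ω * d))) ∈ S
  y₄ : (σ θ * (c + (ω + 1) * d), σ θ * σ b) ∈ S

/-- The vectors come from the restrictions of the functional to the four families
`x = θ e`, `x = σ(θ) e`, `y = θ e`, `y = σ(θ) e` with `e ∈ E`, all of trace zero over `E`. -/
theorem SexticData.functionalVectors (H : SexticData σ E ω θ) {T : Submodule F K} {a b c d : K}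
    (hT : ∀ x y : K, x + σ (σ x) + σ (σ (σ (σ x))) = 0 → y + σ (σ y) + σ (σ (σ (σ y))) = 0 →
      a * x + b * y + c * (σ (σ x) + σ y) + d * (σ x + σ (σ (σ y))) ∈ T) :
    FunctionalVectors σ ω θ a b c d (graphSpan σ E T) := by
  have h2 := H.two
  have hω := H.omega
  have hθ := H.map_theta
  have hσω := H.map_omega
  have hωE := H.omega_mem
  have hω1 := E.add_mem hωE E.one_mem
  have hω3 : (ω + 1) * ω = 1 := by linear_combination hω - h2
  have n1 : ∀ e ∈ E, ((a + ω * c) * θ) * e + (d * σ θ) * σ e ∈ T := fun e he => by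
    have he' := (H.mem_iff e).1 he
    have := hT (θ * e) 0 (by simp only [map_mul, hθ, he', hσω]; grind) (by simp)
    simp only [map_mul, hθ, he', map_zero] at this
    convert this using 1
    ring
  have n2 : ∀ e ∈ E, ((a + (ω + 1) * c) * σ θ) * e + (d * (ω * θ)) * σ e ∈ T := fun e he => by
    have he' := (H.mem_iff e).1 he
    have := hT (σ θ * e) 0 (by simp only [map_mul, hθ, he', hσω, map_add, map_one]; grind) (by simp)
    simp only [map_mul, hθ, he', hσω, map_zero] at this
    convert this using 1
    ring
  have n3 : ∀ e ∈ E, (b * θ) * e + ((c + (ω + 1) * d) * σ θ) * σ e ∈ T := fun e he => by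
    have he' := (H.mem_iff e).1 he
    have := hT 0 (θ * e) (by simp) (by simp only [map_mul, hθ, he', hσω]; grind)
    simp only [map_mul, hθ, he', hσω, map_zero] at this
    convert this using 1
    ring
  have n4 : ∀ e ∈ E, (b * σ θ) * e + ((c + ω * d) * (ω * θ)) * σ e ∈ T := fun e he => by
    have he' := (H.mem_iff e).1 he
    have := hT 0 (σ θ * e) (by simp) (by simp only [map_mul, hθ, he', hσω, map_add, map_one]; grind)
    simp only [map_mul, hθ, he', hσω, map_zero] at this
    convert this using 1
    grind
  obtain ⟨p1, q1⟩ := H.pair_mem n1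
  obtain ⟨p2, q2⟩ := H.pair_mem n2
  obtain ⟨p3, q3⟩ := H.pair_mem n3
  obtain ⟨p4, q4⟩ := H.pair_mem n4
  simp only [map_mul, hθ, hσω, map_add, map_one] at p1 q1 p2 q2 p3 q3 p4 q4
  refine ⟨?_, ?_, ?_, ?_, ?_, ?_, ?_, ?_⟩ <;> try simp only [map_mul, hσω, map_add, map_one]
  · convert p1 using 1
    refine Prod.ext ?_ ?_ <;> simp only <;> ring
  · convert mul_mem_prod hω1 q2 using 1
    refine Prod.ext ?_ ?_ <;> simp only <;> grind
  · convert p3 using 1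
    refine Prod.ext ?_ ?_ <;> simp only <;> ring
  · convert mul_mem_prod hω1 q4 using 1
    refine Prod.ext ?_ ?_ <;> simp only <;> grind
  · convert p2 using 1
    refine Prod.ext ?_ ?_ <;> simp only <;> ring
  · convert q1 using 1
    refine Prod.ext ?_ ?_ <;> simp only <;> grind
  · convert p4 using 1
    refine Prod.ext ?_ ?_ <;> simp only <;> ring
  · convert q3 using 1
    refine Prod.ext ?_ ?_ <;> simp only <;> grind

/-! ### Vanishing of the coefficients -/

theorem SexticData.finiteDimensional (H : SexticData σ E ω θ) : FiniteDimensional E K :=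
  Module.finite_of_finrank_eq_succ H.finrank_eq

/-- A subspace of `K × K` of dimension at most three that projects onto `K` is the graph of an
`E`-linear map. -/
theorem SexticData.exists_graph (H : SexticData σ E ω θ) {S : Submodule E (K × K)}
    (hS : finrank E S ≤ 3) (hsurj : S.map (LinearMap.fst E K K) = ⊤) :
    ∃ ψ : K →ₗ[E] K, ∀ x y, (x, y) ∈ S → ψ x = y := by
  have := H.finiteDimensional
  have h1 : Function.Surjective ((LinearMap.fst E K K).domRestrict S) := by
    rw [← LinearMap.range_eq_top, LinearMap.range_domRestrict, hsurj]
  have h2 : finrank E S = finrank E K := by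
    refine le_antisymm (by rwa [H.finrank_eq]) ?_
    have h3 := LinearMap.finrank_range_le ((LinearMap.fst E K K).domRestrict S)
    rwa [LinearMap.range_eq_top.2 h1, finrank_top] at h3
  have h3 := (LinearMap.injective_iff_surjective_of_finrank_eq_finrank h2).2 h1
  let e := LinearEquiv.ofBijective _ ⟨h3, h1⟩
  refine ⟨LinearMap.snd E K K ∘ₗ S.subtype ∘ₗ e.symm.toLinearMap, fun x y hxy => ?_⟩
  have h4 : e.symm x = ⟨(x, y), hxy⟩ := by
    rw [LinearEquiv.symm_apply_eq]
    rfl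
  change ((e.symm x : K × K)).2 = y
  rw [h4]

/-- `θ ^ 2`, `θ σ(θ)` and `σ(θ) ^ 2` are eigenvectors of `σ ^ 2` for different eigenvalues. -/
theorem SexticData.quadratic_relation (H : SexticData σ E ω θ) {e₀ e₁ e₂ : K}
    (h₀ : e₀ ∈ E) (h₁ : e₁ ∈ E) (h₂ : e₂ ∈ E) (h : e₀ * θ ^ 2 + e₁ * (θ * σ θ) + e₂ * σ θ ^ 2 = 0) :
    e₀ = 0 ∧ e₁ = 0 ∧ e₂ = 0 := by
  have h2 := H.two
  have hω := H.omega
  have hωω := (H.mem_iff _).1 H.omega_mem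
  rw [H.mem_iff] at h₀ h₁ h₂
  have k1 := congrArg (fun z => σ (σ z)) h
  simp only [map_add, map_mul, map_pow, map_zero, H.map_theta, h₀, h₁, h₂, H.map_omega]
    at k1
  have k2 := congrArg (fun z => σ (σ z)) k1
  simp only [map_add, map_mul, map_pow, map_zero, H.map_theta, h₀, h₁, h₂, H.map_omega, map_one]
    at k2
  have hθ := H.theta_ne
  have hσθ : σ θ ≠ 0 := by simpa using hθ
  have e1 : e₁ * (θ * σ θ) = 0 := by grind
  have e0 : e₀ * θ ^ 2 = 0 := by grind
  have e2 : e₂ * σ θ ^ 2 = 0 := by grind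
  simpa [hθ, hσθ] using And.intro e0 (And.intro e1 e2)

/-- If `M` has dimension at least two over `E`, then `θ M + σ(θ) M = K`: a subspace of dimension two
cannot be stable under multiplication by `σ(θ) / θ`, which generates `K` over `E`. -/
theorem SexticData.eq_top (H : SexticData σ E ω θ) {P : Submodule E K} {κ m : K} (hκ : κ ≠ 0)
    (hm : m / κ ∉ E) (h1 : θ * κ ∈ P) (h2 : θ * m ∈ P) (h3 : σ θ * κ ∈ P) (h4 : σ θ * m ∈ P) :
    P = ⊤ := by
  have := H.finiteDimensional
  have hθ := H.theta_ne
  apply Submodule.eq_top_of_finrank_eq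
  refine (Submodule.finrank_le P).antisymm ?_
  rw [H.finrank_eq]
  by_contra hlt
  have hli : LinearIndependent E ![θ * κ, θ * m] := by
    rw [LinearIndependent.pair_iff]
    intro s t hst
    change (s : K) * (θ * κ) + (t : K) * (θ * m) = 0 at hst
    have h5 : (s : K) * κ + (t : K) * m = 0 := by
      apply mul_left_cancel₀ hθ
      linear_combination hst
    have ht : (t : K) = 0 := by
      by_contra ht
      apply hm
      have h6 : m / κ = -(s : K) / t := by
        field_simp
        linear_combination h5
      rw [h6]
      exact E.div_mem (E.neg_mem s.2) t.2
    have hs : (s : K) = 0 := by simpa [ht, hκ] using h5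
    exact ⟨Subtype.ext hs, Subtype.ext ht⟩
  have hle : Submodule.span E (Set.range ![θ * κ, θ * m]) ≤ P := by
    rw [Submodule.span_le]
    rintro _ ⟨i, rfl⟩
    fin_cases i <;> assumption
  have heq := Submodule.eq_of_le_of_finrank_le hle (by
    rw [finrank_span_eq_card hli, Fintype.card_fin]
    omega)
  -- then `P` is stable under multiplication by `σ θ / θ`
  have h5 : σ θ * σ θ / θ * κ ∈ P := by
    have h6 := h3
    rw [← heq, Matrix.range_cons, Matrix.range_cons, Matrix.range_empty, Set.union_empty,
      Set.singleton_union, Submodule.mem_span_pair] at h6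
    obtain ⟨s, t, hst⟩ := h6
    change (s : K) * (θ * κ) + (t : K) * (θ * m) = σ θ * κ at hst
    have h7 := P.add_mem (P.smul_mem s h3) (P.smul_mem t h4)
    change (s : K) * (σ θ * κ) + (t : K) * (σ θ * m) ∈ P at h7
    convert h7 using 1
    field_simp
    linear_combination (-σ θ) * hst
  have hli3 : LinearIndependent E ![θ * κ, σ θ * κ, σ θ * σ θ / θ * κ] := by
    rw [Fintype.linearIndependent_iff]
    intro e he
    rw [Fin.sum_univ_three] at he
    change (e 0 : K) * (θ * κ) + (e 1 : K) * (σ θ * κ) + (e 2 : K) * (σ θ * σ θ / θ * κ) = 0 at he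
    obtain ⟨k0, k1, k2⟩ := H.quadratic_relation (e 0).2 (e 1).2 (e 2).2 (by
      apply mul_right_cancel₀ hκ
      field_simp at he
      linear_combination he)
    intro i
    apply Subtype.ext
    fin_cases i <;> assumption
  have hle3 : Submodule.span E (Set.range ![θ * κ, σ θ * κ, σ θ * σ θ / θ * κ]) ≤ P := by
    rw [Submodule.span_le]
    rintro _ ⟨i, rfl⟩
    fin_cases i <;> assumption
  have := Submodule.finrank_mono hle3
  rw [finrank_span_eq_card hli3, Fintype.card_fin] at this
  omega

theorem FunctionalVectors.mul_mem_fst (H : SexticData σ E ω θ) {a b c d : K}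
    {S : Submodule E (K × K)} (hS : FunctionalVectors σ ω θ a b c d S)
    {z : K} (hz : z ∈ ({a, b, c, d} : Set K)) :
    θ * z ∈ S.map (LinearMap.fst E K K) ∧ σ θ * z ∈ S.map (LinearMap.fst E K K) := by
  have hωE := H.omega_mem
  have hω1 := E.add_mem hωE E.one_mem
  have hfst : ∀ {x y}, (x, y) ∈ S → x ∈ S.map (LinearMap.fst E K K) := fun h => ⟨_, h, rfl⟩
  set P := S.map (LinearMap.fst E K K)
  have hmul : ∀ {e x}, e ∈ E → x ∈ P → e * x ∈ P := fun {e x} he hx => P.smul_mem ⟨e, he⟩ hx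
  have xd := hfst hS.x₂
  have xb := hfst hS.x₃
  have xc : θ * c ∈ P := by
    convert P.sub_mem (hfst hS.x₄) (hmul hωE xd) using 1
    ring
  have xa : θ * a ∈ P := by
    convert P.sub_mem (hfst hS.x₁) (hmul hωE xc) using 1
    ring
  have yd := hfst hS.y₂
  have yb := hfst hS.y₃
  have yc : σ θ * c ∈ P := by
    convert P.sub_mem (hfst hS.y₄) (hmul hω1 yd) using 1
    ring
  have ya : σ θ * a ∈ P := by
    convert P.sub_mem (hfst hS.y₁) (hmul hω1 yc) using 1
    ring
  rcases hz with rfl | rfl | rfl | rfl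
  exacts [⟨xa, ya⟩, ⟨xb, yb⟩, ⟨xc, yc⟩, ⟨xd, yd⟩]

/-- The additive map `z ↦ σ⁻¹(ψ(t z) / t)`. -/
def twist (σ : K ≃ₐ[F] K) (ψ : K →ₗ[E] K) (t : K) : K →+ K where
  toFun z := σ.symm (ψ (t * z) / t)
  map_zero' := by simp
  map_add' x y := by simp [mul_add, add_div]

theorem SexticData.twist_mul (H : SexticData σ E ω θ) (ψ : K →ₗ[E] K) (t : K) {e : K} (he : e ∈ E)
    (z : K) : twist σ ψ t (e * z) = σ e * twist σ ψ t z := by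
  change σ.symm (ψ (t * (e * z)) / t) = σ e * σ.symm (ψ (t * z) / t)
  have h1 : t * (e * z) = (⟨e, he⟩ : E) • (t * z) := by
    change _ = e * (t * z)
    ring
  rw [h1, map_smul]
  change σ.symm (e * ψ (t * z) / t) = _
  rw [mul_div_assoc, map_mul]
  congr 1
  rw [AlgEquiv.symm_apply_eq]
  exact ((H.mem_iff e).1 he).symm

theorem twist_eq {ψ : K →ₗ[E] K} {t : K} (ht : t ≠ 0) {x y : K} (h : ψ (t * x) = t * σ y) :
    twist σ ψ t x = y := by
  change σ.symm (ψ (t * x) / t) = y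
  rw [h, mul_div_cancel_left₀ _ ht, AlgEquiv.symm_apply_apply]

/-- When the coefficients span over `E` a space of dimension at least two, `S` is the graph of an
`E`-linear map, and twisting it yields two semilinear maps on the span of the coefficients. -/
theorem SexticData.false_of_rank_two (H : SexticData σ E ω θ) {a b c d : K}
    {S : Submodule E (K × K)} (hS : FunctionalVectors σ ω θ a b c d S)
    (hdim : finrank E S ≤ 3) {κ m : K}
    (hκ : κ ∈ ({a, b, c, d} : Set K)) (hm : m ∈ ({a, b, c, d} : Set K)) (hκ0 : κ ≠ 0)
    (hmκ : m / κ ∉ E) : False := by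
  have h2 := H.two
  have hω := H.omega
  have hσω := H.map_omega
  have hωE := H.omega_mem
  have hω1 := E.add_mem hωE E.one_mem
  have hσω1 : σ (ω + 1) = ω := by
    rw [map_add, map_one, hσω]
    linear_combination h2
  obtain ⟨ψ, hψ⟩ := H.exists_graph hdim (H.eq_top hκ0 hmκ (hS.mul_mem_fst H hκ).1
    (hS.mul_mem_fst H hm).1 (hS.mul_mem_fst H hκ).2 (hS.mul_mem_fst H hm).2)
  have hθ := H.theta_ne
  have hσθ : σ θ ≠ 0 := by simpa using hθ
  obtain ⟨X, hX⟩ : ∃ X, X = twist σ ψ θ := ⟨_, rfl⟩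
  obtain ⟨Y, hY⟩ : ∃ Y, Y = twist σ ψ (σ θ) := ⟨_, rfl⟩
  have Xmul : ∀ e ∈ E, ∀ z, X (e * z) = σ e * X z := hX ▸ fun e he z => H.twist_mul ψ _ he z
  have Ymul : ∀ e ∈ E, ∀ z, Y (e * z) = σ e * Y z := hY ▸ fun e he z => H.twist_mul ψ _ he z
  have x1 : X (a + ω * c) = (ω + 1) * d := by
    rw [hX]
    apply twist_eq hθ
    rw [hψ _ _ hS.x₁, map_mul, hσω1]
  have x2 : X d = a + (ω + 1) * c := by
    rw [hX]
    exact twist_eq hθ (hψ _ _ hS.x₂)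
  have x3 : X b = (ω + 1) * (c + (ω + 1) * d) := by
    rw [hX]
    apply twist_eq hθ
    rw [hψ _ _ hS.x₃, map_mul σ (ω + 1), hσω1]
  have x4 : X (c + ω * d) = b := by
    rw [hX]
    exact twist_eq hθ (hψ _ _ hS.x₄)
  have y1 : Y (a + (ω + 1) * c) = ω * d := by
    rw [hY]
    apply twist_eq hσθ
    rw [hψ _ _ hS.y₁, map_mul, hσω]
  have y2 : Y d = a + ω * c := by
    rw [hY]
    exact twist_eq hσθ (hψ _ _ hS.y₂)
  have y3 : Y b = ω * (c + ω * d) := by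
    rw [hY]
    apply twist_eq hσθ
    rw [hψ _ _ hS.y₃, map_mul σ ω, hσω]
  have y4 : Y (c + (ω + 1) * d) = b := by
    rw [hY]
    exact twist_eq hσθ (hψ _ _ hS.y₄)
  rw [map_add, Xmul ω hωE, hσω] at x1 x4
  rw [map_add, Ymul _ hω1, hσω1] at y1 y4
  clear hX hY hψ hS hm hmκ
  let ζ : K →+ K := (AddMonoidHom.mulLeft ω).comp X + (AddMonoidHom.mulLeft (ω + 1)).comp Y
  have hζ : ∀ z, ζ z = ω * X z + (ω + 1) * Y z := fun z => rfl
  have hη : ∀ z, (X + Y) z = X z + Y z := fun z => rfl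
  have xc : X c = b - (ω + 1) * X d := by linear_combination x4
  have xa : X a = (ω + 1) * d - (ω + 1) * X c := by linear_combination x1
  have yc : Y c = b - ω * Y d := by linear_combination y4
  have ya : Y a = ω * d - ω * Y c := by linear_combination y1
  rw [x2] at xc
  rw [xc] at xa
  rw [y2] at yc
  rw [yc] at ya
  clear x1 x4 y1 y4
  refine hκ0 (H.eq_zero_of_semilinear (a := a) (b := b) (c := c) (d := d) ζ (X + Y)
    (fun e he z => ?_) (fun e he z => ?_) ?_ ?_ ?_ ?_ ?_ ?_ ?_ ?_ (Submodule.subset_span hκ))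
  · rw [hζ, hζ, Xmul e he, Ymul e he]
    ring
  · rw [hη, hη, Xmul e he, Ymul e he]
    ring
  · rw [hζ, xa, ya]
    clear Xmul Ymul hζ hη x2 y2 x3 y3 xa ya xc yc
    grind
  · rw [hζ, x3, y3]
    clear Xmul Ymul hζ hη x2 y2 x3 y3 xa ya xc yc
    grind
  · rw [hζ, xc, yc]
    clear Xmul Ymul hζ hη x2 y2 x3 y3 xa ya xc yc
    grind
  · rw [hζ, x2, y2]
    clear Xmul Ymul hζ hη x2 y2 x3 y3 xa ya xc yc
    grind
  · rw [hη, xa, ya]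
    clear Xmul Ymul hζ hη x2 y2 x3 y3 xa ya xc yc
    grind
  · rw [hη, x3, y3]
    clear Xmul Ymul hζ hη x2 y2 x3 y3 xa ya xc yc
    grind
  · rw [hη, xc, yc]
    clear Xmul Ymul hζ hη x2 y2 x3 y3 xa ya xc yc
    grind
  · rw [hη, x2, y2]
    clear Xmul Ymul hζ hη x2 y2 x3 y3 xa ya xc yc
    grind

/-- When the coefficients lie in `E`, one of the two halves of the eight vectors spans a line, and
the norm to `F` of the slope of this line leads to a nontrivial cube root of unity in `F`. -/
theorem SexticData.eq_zero_of_mem (H : SexticData σ E ω θ) {a b c d : K} {S : Submodule E (K × K)}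
    (hS : FunctionalVectors σ ω θ a b c d S) (hdim : finrank E S ≤ 3) (ha : a ∈ E)
    (hb : b ∈ E) (hc : c ∈ E) (hd : d ∈ E) : a = 0 ∧ b = 0 ∧ c = 0 ∧ d = 0 := by
  have := H.finiteDimensional
  have h2 := H.two
  have hω := H.omega
  have hσω := H.map_omega
  have hωE := H.omega_mem
  have hω1 := E.add_mem hωE E.one_mem
  have hθ := H.theta_ne
  have hσθ : σ θ ≠ 0 := by simpa using hθ
  have hσ : ∀ {e}, e ∈ E → σ e ∈ E := H.map_mem
  by_contra hne
  -- the slope of the line spanned by the half of the vectors that is multiplied by `t`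
  have hslope : ∀ t : K, t ≠ 0 → ∀ w ∈ E, w ^ 2 + w + 1 = 0 →
      (t * (a + w * c), t * (w * σ d)) ∈ S → (t * d, t * σ (a + (w + 1) * c)) ∈ S →
      (t * b, t * (w * σ (c + (w + 1) * d))) ∈ S → (t * (c + w * d), t * σ b) ∈ S →
      ∃ μ ∈ E, (t, t * μ) ∈ S := by
    intro t ht w hw hw0 m1 m2 m3 m4
    have hw1 := E.add_mem hw E.one_mem
    have hgen : ∀ p ∈ E, ∀ q ∈ E, p ≠ 0 → (t * p, t * q) ∈ S → ∃ μ ∈ E, (t, t * μ) ∈ S := by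
      intro p hp q hq hp0 hpq
      refine ⟨q / p, E.div_mem hq hp, ?_⟩
      convert mul_mem_prod (E.inv_mem hp) hpq using 1
      refine Prod.ext ?_ ?_ <;> field_simp
    by_cases d0 : d = 0
    · by_cases b0 : b = 0
      · by_cases c0 : c = 0
        · by_cases a0 : a = 0
          · exact absurd ⟨a0, b0, c0, d0⟩ hne
          · exact hgen _ (E.add_mem ha (E.mul_mem hw hc)) _ (E.mul_mem hw (hσ hd))
              (by simpa [c0] using a0) m1
        · exact hgen _ (E.add_mem hc (E.mul_mem hw hd)) _ (hσ hb) (by simpa [d0] using c0) m4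
      · exact hgen _ hb _ (E.mul_mem hw (hσ (E.add_mem hc (E.mul_mem hw1 hd)))) b0 m3
    · exact hgen _ hd _ (hσ (E.add_mem ha (E.mul_mem hw1 hc))) d0 m2
  have hline : ∀ t : K, t ≠ 0 → (0, t) ∉ S → ∀ w ∈ E, w ^ 2 + w + 1 = 0 → σ w = w + 1 →
      (t * (a + w * c), t * (w * σ d)) ∈ S → (t * d, t * σ (a + (w + 1) * c)) ∈ S →
      (t * b, t * (w * σ (c + (w + 1) * d))) ∈ S → (t * (c + w * d), t * σ b) ∈ S → False := by
    intro t ht h0 w hw hw0 hσw m1 m2 m3 m4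
    have hw1 := E.add_mem hw E.one_mem
    obtain ⟨μ, hμ, hμS⟩ := hslope t ht w hw hw0 m1 m2 m3 m4
    have hgen : ∀ p ∈ E, ∀ q ∈ E, (t * p, t * q) ∈ S → q = μ * p := by
      intro p hp q hq hpq
      by_contra hqp
      have h5 : q - μ * p ≠ 0 := sub_ne_zero.2 hqp
      apply h0
      convert mul_mem_prod (E.inv_mem (E.sub_mem hq (E.mul_mem hμ hp)))
        (S.sub_mem hpq (mul_mem_prod hp hμS)) using 1
      refine Prod.ext ?_ ?_
      · simp only
        ring
      · simp only
        field_simp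
    refine hne (H.eq_zero_of_slope (w := w) (μ := μ) hw0 hσw hc hd hμ ha ?_ ?_ ?_ ?_)
    · exact hgen _ (E.add_mem ha (E.mul_mem hw hc)) _ (E.mul_mem hw (hσ hd)) m1
    · exact hgen _ hd _ (hσ (E.add_mem ha (E.mul_mem hw1 hc))) m2
    · exact hgen _ hb _ (E.mul_mem hw (hσ (E.add_mem hc (E.mul_mem hw1 hd)))) m3
    · exact hgen _ (E.add_mem hc (E.mul_mem hw hd)) _ (hσ hb) m4
  have hw' : (ω + 1) ^ 2 + (ω + 1) + 1 = 0 := by linear_combination hω + (ω + 1) * h2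
  have hω2 : ω + 1 + 1 = ω := by linear_combination h2
  have hσω1 : σ (ω + 1) = ω + 1 + 1 := by rw [map_add, map_one, hσω]
  -- if neither half spans a line, `S` has dimension at least four
  have hx : (0, θ) ∈ S := by
    by_contra h0
    exact hline θ hθ h0 ω hωE hω hσω hS.x₁ hS.x₂ hS.x₃ hS.x₄
  have hy : (0, σ θ) ∈ S := by
    by_contra h0
    refine hline (σ θ) hσθ h0 (ω + 1) hω1 hw' hσω1 hS.y₁ ?_ ?_ hS.y₄
    · rw [hω2]
      exact hS.y₂
    · rw [hω2]
      exact hS.y₃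
  obtain ⟨μ, hμ, hμS⟩ := hslope θ hθ ω hωE hω hS.x₁ hS.x₂ hS.x₃ hS.x₄
  obtain ⟨ν, hν, hνS⟩ := hslope (σ θ) hσθ (ω + 1) hω1 hw' hS.y₁ (by rw [hω2]; exact hS.y₂)
    (by rw [hω2]; exact hS.y₃) hS.y₄
  have hlin : ∀ s ∈ E, ∀ t ∈ E, s * θ + t * σ θ = 0 → s = 0 ∧ t = 0 := by
    intro s hs t ht hst
    obtain ⟨k1, k2, -⟩ := H.quadratic_relation hs ht E.zero_mem
      (by linear_combination θ * hst)
    exact ⟨k1, k2⟩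
  have hli : LinearIndependent E ![((0 : K), θ), (0, σ θ), (θ, θ * μ), (σ θ, σ θ * ν)] := by
    rw [Fintype.linearIndependent_iff]
    intro e he
    rw [Fin.sum_univ_four] at he
    have he1 : (e 0 : K) * 0 + (e 1 : K) * 0 + (e 2 : K) * θ + (e 3 : K) * σ θ = 0 :=
      congrArg Prod.fst he
    have he2 : (e 0 : K) * θ + (e 1 : K) * σ θ + (e 2 : K) * (θ * μ) +
      (e 3 : K) * (σ θ * ν) = 0 := congrArg Prod.snd he
    obtain ⟨k2, k3⟩ := hlin _ (e 2).2 _ (e 3).2 (by linear_combination he1)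
    obtain ⟨k0, k1⟩ := hlin _ (e 0).2 _ (e 1).2
      (by linear_combination he2 - θ * μ * k2 - σ θ * ν * k3)
    intro i
    apply Subtype.ext
    fin_cases i <;> assumption
  have hle : Submodule.span E (Set.range ![((0 : K), θ), (0, σ θ), (θ, θ * μ), (σ θ, σ θ * ν)]) ≤
      S := by
    rw [Submodule.span_le]
    rintro _ ⟨i, rfl⟩
    fin_cases i <;> assumption
  have h5 := Submodule.finrank_mono hle
  rw [finrank_span_eq_card hli, Fintype.card_fin] at h5
  omega

/-- Dividing the coefficients by `κ` corresponds to scaling the coordinates of `K × K` by `κ⁻¹` and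
`σ(κ)⁻¹`. -/
theorem FunctionalVectors.scale {a b c d : K} {S : Submodule E (K × K)}
    (hS : FunctionalVectors σ ω θ a b c d S) (κ : K) :
    FunctionalVectors σ ω θ (a / κ) (b / κ) (c / κ) (d / κ)
      (S.map (LinearMap.prodMap (LinearMap.mulLeft E κ⁻¹) (LinearMap.mulLeft E (σ κ)⁻¹))) := by
  have h1 : ∀ {x y x' y' : K}, (x, y) ∈ S → κ⁻¹ * x = x' → (σ κ)⁻¹ * y = y' →
      (x', y') ∈
        S.map (LinearMap.prodMap (LinearMap.mulLeft E κ⁻¹) (LinearMap.mulLeft E (σ κ)⁻¹)) := by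
    rintro x y _ _ h rfl rfl
    exact ⟨_, h, rfl⟩
  refine ⟨h1 hS.x₁ ?_ ?_, h1 hS.x₂ ?_ ?_, h1 hS.x₃ ?_ ?_, h1 hS.x₄ ?_ ?_, h1 hS.y₁ ?_ ?_,
    h1 hS.y₂ ?_ ?_, h1 hS.y₃ ?_ ?_, h1 hS.y₄ ?_ ?_⟩ <;>
  first | ring1 | (simp only [map_div₀, map_add, map_mul, map_one]; ring1)

/-- After division by a nonzero coefficient `κ`, either all coefficients lie in `E`, or two of them
are independent over `E`. -/
theorem SexticData.coeff_eq_zero (H : SexticData σ E ω θ) {a b c d : K} {S : Submodule E (K × K)}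
    (hS : FunctionalVectors σ ω θ a b c d S) (hdim : finrank E S ≤ 3) :
    a = 0 ∧ b = 0 ∧ c = 0 ∧ d = 0 := by
  have := H.finiteDimensional
  by_contra hne
  obtain ⟨κ, hκ, hκ0⟩ : ∃ κ ∈ ({a, b, c, d} : Set K), κ ≠ 0 := by
    by_contra hall
    push Not at hall
    exact hne ⟨hall a (by simp), hall b (by simp), hall c (by simp), hall d (by simp)⟩
  by_cases hE : ∀ z ∈ ({a, b, c, d} : Set K), z / κ ∈ E
  · have h1 := H.eq_zero_of_mem (hS.scale κ) ((Submodule.finrank_map_le _ _).trans hdim)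
      (hE a (by simp)) (hE b (by simp)) (hE c (by simp)) (hE d (by simp))
    simp only [div_eq_zero_iff, hκ0, or_false] at h1
    exact hne h1
  · push Not at hE
    obtain ⟨m, hm, hmE⟩ := hE
    exact H.false_of_rank_two hS hdim hκ hm hκ0 hmE

end CubicExtension

/-! ### Direct sums -/

section DirectSums

variable {F K : Type*} [Field F] [Field K] [Algebra F K]

theorem MinRank.prod [FiniteDimensional F K] {V₁ V₂ : Type*}
    [AddCommGroup V₁] [Module K V₁] [Module F V₁] [IsScalarTower F K V₁]
    [AddCommGroup V₂] [Module K V₂] [Module F V₂] [IsScalarTower F K V₂] {d : ℕ}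
    {U₁ : Submodule F V₁} {U₂ : Submodule F V₂} (h₁ : MinRank (K := K) d U₁)
    (h₂ : MinRank (K := K) d U₂) : MinRank (K := K) d (U₁.prod U₂) := by
  intro φ hφ
  -- `φ` is nonzero on one of the summands, and `φ(U₁ × U₂)` contains the image of that part
  by_cases h : φ ∘ₗ LinearMap.inl K V₁ V₂ = 0
  · have h' : φ ∘ₗ LinearMap.inr K V₁ V₂ ≠ 0 := fun h' =>
      hφ (LinearMap.prod_ext (by rw [h, LinearMap.zero_comp]) (by rw [h', LinearMap.zero_comp]))
    refine (h₂ _ h').trans (Submodule.finrank_mono ?_)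
    rintro _ ⟨u, hu, rfl⟩
    exact ⟨(0, u), ⟨U₁.zero_mem, hu⟩, rfl⟩
  · refine (h₁ _ h).trans (Submodule.finrank_mono ?_)
    rintro _ ⟨u, hu, rfl⟩
    exact ⟨(u, 0), ⟨hu, U₂.zero_mem⟩, rfl⟩

theorem MinRank.pi [FiniteDimensional F K] {ι : Type*} [Finite ι] {V : Type*}
    [AddCommGroup V] [Module K V] [Module F V] [IsScalarTower F K V] {d : ℕ}
    {U : ι → Submodule F V} (hU : ∀ i, MinRank (K := K) d (U i)) :
    MinRank (K := K) d (Submodule.pi Set.univ U) := by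
  classical
  intro φ hφ
  obtain ⟨i, hi⟩ : ∃ i, φ ∘ₗ LinearMap.single K (fun _ => V) i ≠ 0 := by
    by_contra! h
    exact hφ (LinearMap.pi_ext' fun i => by rw [h i, LinearMap.zero_comp])
  refine (hU i _ hi).trans (Submodule.finrank_mono ?_)
  rintro _ ⟨u, hu, rfl⟩
  exact ⟨Pi.single i u, Submodule.le_comap_single_pi U hu, rfl⟩

theorem finrank_submodule_prod {V₁ V₂ : Type*} [AddCommGroup V₁] [Module F V₁]
    [AddCommGroup V₂] [Module F V₂] (U₁ : Submodule F V₁) (U₂ : Submodule F V₂)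
    [FiniteDimensional F U₁] [FiniteDimensional F U₂] :
    finrank F (U₁.prod U₂) = finrank F U₁ + finrank F U₂ := by
  have h1 : Function.Injective (U₁.subtype.prodMap U₂.subtype) :=
    Function.Injective.prodMap U₁.injective_subtype U₂.injective_subtype
  rw [← finrank_prod, ← LinearMap.finrank_range_of_inj h1, LinearMap.range_prodMap,
    Submodule.range_subtype, Submodule.range_subtype]

theorem finrank_submodule_pi {ι V : Type*} [Fintype ι] [AddCommGroup V] [Module F V]
    (U : ι → Submodule F V) [∀ i, FiniteDimensional F (U i)] :
    finrank F (Submodule.pi Set.univ U) = ∑ i, finrank F (U i) := by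
  let g : (∀ i, U i) →ₗ[F] (ι → V) := LinearMap.pi fun i => (U i).subtype ∘ₗ LinearMap.proj i
  have h1 : Function.Injective g := fun u v huv => funext fun i => Subtype.ext (congrFun huv i)
  have h2 : LinearMap.range g = Submodule.pi Set.univ U := by
    ext v
    constructor
    · rintro ⟨u, rfl⟩ i -
      exact (u i).2
    · intro hv
      exact ⟨fun i => ⟨v i, hv i trivial⟩, rfl⟩
  rw [← h2, LinearMap.finrank_range_of_inj h1, finrank_pi_fintype]

end DirectSums

/-! ### The examples in dimensions three and four -/

section Examples

variable {F K : Type*} [Field F] [Fintype F] [Field K] [Algebra F K]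

theorem exists_frobenius_pow [FiniteDimensional F K] (s : ℕ) :
    ∃ σ : K ≃ₐ[F] K, σ = FiniteField.frobeniusAlgEquivOfAlgebraic F K ^ s ∧
      ∀ x, σ x = x ^ Fintype.card F ^ s := by
  refine ⟨_, rfl, fun x => ?_⟩
  rw [AlgEquiv.coe_pow, FiniteField.coe_frobeniusAlgEquivOfAlgebraic_iterate]

/-- The subspace `{(x, x ^ q, x ^ q ^ 2)}` of `K ^ 3`. -/
def exampleThree (F K : Type*) [Field F] [Fintype F] [Field K] [Algebra F K] :
    Submodule F (Fin 3 → K) :=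
  LinearMap.range (LinearMap.pi fun i : Fin 3 =>
    (FiniteField.frobeniusAlgHom F K ^ (i : ℕ)).toLinearMap)

theorem frobeniusAlgHom_pow_apply (x : K) (i : Fin 3) :
    (FiniteField.frobeniusAlgHom F K ^ (i : ℕ)).toLinearMap x = x ^ Fintype.card F ^ (i : ℕ) := by
  change (FiniteField.frobeniusAlgHom F K ^ (i : ℕ)) x = _
  rw [AlgHom.coe_pow, FiniteField.coe_frobeniusAlgHom, pow_iterate]

theorem finrank_exampleThree [FiniteDimensional F K] :
    finrank F (exampleThree F K) = finrank F K := by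
  apply LinearMap.finrank_range_of_inj
  intro x y hxy
  have := congrFun hxy 0
  simpa [frobeniusAlgHom_pow_apply] using this

/-- The functional with coefficients `a, b, c` vanishes at `(x, x ^ q, x ^ q ^ 2)` for at most
`q ^ 2` elements `x`, the roots of `a X + b X ^ q + c X ^ q ^ 2`. -/
theorem minRank_exampleThree [FiniteDimensional F K] {d : ℕ} (hd : d + 2 ≤ finrank F K) :
    MinRank (K := K) d (exampleThree F K) := by
  classical
  have : Finite K := Module.finite_of_finite F
  have : Fintype K := Fintype.ofFinite K
  intro φ hφ
  set q := Fintype.card F with hq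
  have hq1 : 1 < q := Fintype.one_lt_card
  let c : Fin 3 → K := fun i => φ (Pi.single i 1)
  have hφc : ∀ v, φ v = ∑ i, c i * v i := functional_eq_sum φ
  let p : Polynomial K := ∑ i, Polynomial.C (c i) * Polynomial.X ^ q ^ (i : ℕ)
  have hp0 : p ≠ 0 := by
    intro h0
    apply hφ
    have hc : ∀ i, c i = 0 := by
      intro i
      have h1 := congrArg (fun f => Polynomial.coeff f (q ^ (i : ℕ))) h0
      simp only [p, Polynomial.finsetSum_coeff, Polynomial.coeff_C_mul_X_pow,
        Polynomial.coeff_zero] at h1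
      rw [Finset.sum_eq_single i] at h1
      · simpa using h1
      · intro j _ hj
        rw [if_neg]
        intro h2
        exact hj (Fin.ext (Nat.pow_right_injective hq1 h2).symm)
      · simp
    ext1 i
    ext
    simpa using hc i
  have hpdeg : p.natDegree ≤ q ^ 2 := by
    refine Polynomial.natDegree_sum_le_of_forall_le _ _ fun i _ => ?_
    exact (Polynomial.natDegree_C_mul_X_pow_le _ _).trans
      (Nat.pow_le_pow_right (by omega) (by omega))
  let g : K →ₗ[F] K := φ.restrictScalars F ∘ₗ
    LinearMap.pi fun i : Fin 3 => (FiniteField.frobeniusAlgHom F K ^ (i : ℕ)).toLinearMap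
  have hg : ∀ x, g x = p.eval x := by
    intro x
    change φ _ = _
    rw [hφc, Polynomial.eval_finsetSum]
    refine Finset.sum_congr rfl fun i _ => ?_
    rw [LinearMap.pi_apply, frobeniusAlgHom_pow_apply]
    simp [hq]
  have hker : finrank F (LinearMap.ker g) ≤ 2 := by
    have h1 : Fintype.card (LinearMap.ker g) ≤ q ^ 2 := by
      refine le_trans ?_ ((Polynomial.card_roots' p).trans hpdeg)
      refine le_trans ?_ (Multiset.toFinset_card_le _)
      rw [← Fintype.card_coe]
      refine Fintype.card_le_of_injective
        (fun x : LinearMap.ker g => (⟨x, ?_⟩ : {y // y ∈ p.roots.toFinset})) fun x y hxy => ?_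
      · rw [Multiset.mem_toFinset, Polynomial.mem_roots hp0, Polynomial.IsRoot, ← hg]
        exact x.2
      · exact Subtype.ext (by simpa using hxy)
    rw [Module.card_eq_pow_finrank (K := F)] at h1
    exact (Nat.pow_le_pow_iff_right hq1).1 h1
  have h1 := LinearMap.finrank_range_add_finrank_ker g
  rw [LinearMap.range_comp] at h1
  change finrank F ((exampleThree F K).map (φ.restrictScalars F)) + _ = _ at h1
  omega

/-- For `q = 2 ^ h` and `s` with `h` and `s` odd, `σ : x ↦ x ^ q ^ s` squares the third roots of
unity, and its square raises the fifteenth roots of unity to the fourth power. -/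
theorem exists_sexticData [FiniteDimensional F K] {h s : ℕ} (hh : Odd h)
    (hF : Fintype.card F = 2 ^ h) (hK : finrank F K = 6) (hs : Nat.Coprime 6 s)
    {σ : K ≃ₐ[F] K} (hσ : σ = FiniteField.frobeniusAlgEquivOfAlgebraic F K ^ s)
    (hσx : ∀ x, σ x = x ^ Fintype.card F ^ s) :
    ∃ (E : IntermediateField F K) (ω θ : K), SexticData σ E ω θ := by
  classical
  have : Finite K := Module.finite_of_finite F
  have : Fintype K := Fintype.ofFinite K
  have hodd : Odd (h * s) := by
    refine hh.mul (Nat.not_even_iff_odd.1 fun he => ?_)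
    have := Nat.dvd_gcd (show 2 ∣ 6 by norm_num) he.two_dvd
    rw [hs] at this
    omega
  obtain ⟨k, hk⟩ := hodd
  have hpow : Fintype.card F ^ s = 2 * 4 ^ k := by
    rw [hF, ← pow_mul, hk, pow_succ, pow_mul, mul_comm]
    norm_num
  rw [hpow] at hσx
  have htwo : (2 : K) = 0 := by
    have h1 : ((Fintype.card F : ℕ) : F) = 0 := Nat.cast_card_eq_zero F
    rw [hF, Nat.cast_pow] at h1
    have h2 : ((2 : ℕ) : F) = 0 := eq_zero_of_pow_eq_zero (n := h) (by exact_mod_cast h1)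
    have h3 := congrArg (algebraMap F K) h2
    rwa [map_natCast, map_zero, Nat.cast_ofNat] at h3
  have hord : orderOf σ = 6 := by
    have h1 : orderOf (FiniteField.frobeniusAlgEquivOfAlgebraic F K) = 6 := by
      rw [FiniteField.orderOf_frobeniusAlgEquivOfAlgebraic, hK]
    rw [hσ, Nat.Coprime.orderOf_pow (by rwa [h1]), h1]
  have hcube : ∀ z : K, z ^ 2 + z + 1 = 0 → σ z = z + 1 := by
    intro z hz
    have h3 : z ^ 3 = 1 := by linear_combination (z - 1) * hz
    rw [hσx]
    have h4 : 2 * 4 ^ k = 3 * (2 * (4 ^ k / 3)) + 2 := by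
      have : 4 ^ k % 3 = 1 := by rw [Nat.pow_mod]; simp
      omega
    rw [h4, pow_add, pow_mul, h3, one_pow]
    linear_combination hz - (z + 1) * htwo
  obtain ⟨ω, hω⟩ : ∃ ω : K, ω ^ 2 + ω + 1 = 0 := by
    have : Fact (Nat.Prime 3) := ⟨Nat.prime_three⟩
    have hdvd : 3 ∣ Fintype.card Kˣ := by
      rw [Fintype.card_units, Module.card_eq_pow_finrank (K := F), hK, hF, ← pow_mul]
      have h1 : 2 ^ (h * 6) % 3 = 1 := by
        rw [mul_comm, pow_mul, Nat.pow_mod]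
        simp
      omega
    obtain ⟨u, hu⟩ := exists_prime_orderOf_dvd_card 3 hdvd
    refine ⟨u, ?_⟩
    have h1 : (u : K) ^ 3 = 1 := by
      rw [← Units.val_pow_eq_pow_val, ← hu, pow_orderOf_eq_one, Units.val_one]
    have h2 : (u : K) - 1 ≠ 0 := by
      intro h0
      have : u = 1 := Units.ext (by rw [Units.val_one]; exact sub_eq_zero.1 h0)
      rw [this, orderOf_one] at hu
      omega
    apply mul_left_cancel₀ h2
    linear_combination h1
  have hσω := hcube ω hω
  have hτω : σ (σ ω) = ω := by
    rw [hσω, map_add, map_one, hσω]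
    linear_combination htwo
  have hσ6 : σ ^ 6 = 1 := by rw [← hord, pow_orderOf_eq_one]
  obtain ⟨θ, hθ0, hθ⟩ : ∃ θ : K, θ ≠ 0 ∧ σ (σ θ) = ω * θ := by
    -- a value of the projector `1 + ω ^ 2 σ ^ 2 + ω σ ^ 4`, which is nonzero by independence of
    -- automorphisms
    have hli := linearIndependent_toLinearMap F K K
    have hinj : Function.Injective fun i : Fin 3 =>
        ((σ ^ (2 * (i : ℕ)) : K ≃ₐ[F] K) : K →ₐ[F] K) := by
      intro i j hij
      have h1 : σ ^ (2 * (i : ℕ)) = σ ^ (2 * (j : ℕ)) := by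
        ext x
        exact DFunLike.congr_fun hij x
      have h2 := pow_injOn_Iio_orderOf (x := σ) (by rw [hord, Set.mem_Iio]; omega)
        (by rw [hord, Set.mem_Iio]; omega) h1
      exact Fin.ext (by simpa using h2)
    have hli3 := Fintype.linearIndependent_iff.1 (hli.comp _ hinj) ![1, ω + 1, ω]
    have hne : ∃ z : K, z + (ω + 1) * σ (σ z) + ω * σ (σ (σ (σ z))) ≠ 0 := by
      by_contra! hall
      have := hli3 (by
        ext z
        rw [Fin.sum_univ_three]
        simpa [AlgEquiv.coe_pow] using hall z) 0
      exact one_ne_zero this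
    obtain ⟨z, hz⟩ := hne
    refine ⟨_, hz, ?_⟩
    have h6 : σ (σ (σ (σ (σ (σ z))))) = z := DFunLike.congr_fun hσ6 z
    simp only [map_add, map_mul, map_one, hτω, h6]
    linear_combination -(σ (σ z) + σ (σ (σ (σ z)))) * hω +
      (σ (σ z) + (ω + 1) * σ (σ (σ (σ z)))) * htwo
  let G := Subgroup.zpowers (σ ^ 2)
  refine ⟨IntermediateField.fixedField G, ω, θ, ?_, ?_, htwo, hω, hσω, hθ0, hθ, ?_, ?_⟩
  · intro x
    rw [IntermediateField.mem_fixedField_iff]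
    refine ⟨fun hx => hx (σ ^ 2) (Subgroup.mem_zpowers _), fun hx f hf => ?_⟩
    have h1 : G ≤ MulAction.stabilizer (K ≃ₐ[F] K) x := by
      rw [Subgroup.zpowers_le]
      exact hx
    exact h1 hf
  · rw [IntermediateField.finrank_fixedField_eq_card, Nat.card_zpowers, orderOf_pow, hord]
    rfl
  · intro z hz hz0
    have h1 := hcube z hz0
    rw [hz] at h1
    exact one_ne_zero (left_eq_add.1 h1)
  · intro y hy hy0
    rw [IntermediateField.mem_fixedField_iff] at hy
    have h1 : σ (σ y) = y := hy (σ ^ 2) (Subgroup.mem_zpowers _)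
    have h15 : y ^ 15 = 1 := by grind
    have hexp : 2 * 4 ^ k * (2 * 4 ^ k) = 15 * (4 * (16 ^ k / 15)) + 4 := by
      have h2 : 16 ^ k % 15 = 1 := by rw [Nat.pow_mod]; simp
      have h3 : 2 * 4 ^ k * (2 * 4 ^ k) = 4 * 16 ^ k := by
        rw [show (16 : ℕ) = 4 * 4 by norm_num, mul_pow]
        ring
      omega
    rw [hσx, hσx, ← pow_mul, hexp, pow_add, pow_mul, h15, one_pow, one_mul] at h1
    have h2 : (1 : K) = 0 := by linear_combination hy0 - h1 - y * htwo
    exact one_ne_zero h2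

/-- In terms of `σ : x ↦ x ^ q ^ s` the defining conditions of `exampleFour` have the same form for
both admissible values of `s`. -/
theorem mem_exampleFour_iff [FiniteDimensional F K] (hK : finrank F K = 6) {s : ℕ}
    (hs : s = 1 ∨ s = 5) {σ : K ≃ₐ[F] K} (hσx : ∀ x, σ x = x ^ Fintype.card F ^ s)
    (v : Fin 4 → K) :
    v ∈ exampleFour F K s ↔ ∃ x y : K, x + σ (σ x) + σ (σ (σ (σ x))) = 0 ∧
      y + σ (σ y) + σ (σ (σ (σ y))) = 0 ∧
      v = ![x, y, σ (σ x) + σ y, σ x + σ (σ (σ y))] := by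
  have : Finite K := Module.finite_of_finite F
  have : Fintype K := Fintype.ofFinite K
  have h6 : ∀ x : K, x ^ Fintype.card F ^ 6 = x := fun x => by
    rw [← hK, ← Module.card_eq_pow_finrank (K := F) (V := K), FiniteField.pow_card]
  have hpp : ∀ (i j : ℕ) (x : K),
      (x ^ Fintype.card F ^ i) ^ Fintype.card F ^ j = x ^ Fintype.card F ^ (i + j) :=
    fun i j x => by rw [← pow_mul, ← pow_add]
  have htr : ∀ x : K, x + x ^ Fintype.card F ^ 2 + x ^ Fintype.card F ^ 4 = 0 ↔
      x + σ (σ x) + σ (σ (σ (σ x))) = 0 := by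
    intro x
    simp only [hσx, hpp]
    rcases hs with rfl | rfl
    · rfl
    · have e1 : x ^ Fintype.card F ^ (5 + 5) = x ^ Fintype.card F ^ 4 := by
        rw [← hpp 6 4, h6]
      have e2 : x ^ Fintype.card F ^ (5 + 5 + 5 + 5) = x ^ Fintype.card F ^ 2 := by
        rw [← hpp 18 2, ← hpp 12 6, h6, ← hpp 6 6, h6, h6]
      rw [e1, e2, add_right_comm]
  have hv : ∀ x y : K, (![x, y, x ^ Fintype.card F ^ (2 * s) + y ^ Fintype.card F ^ s,
      x ^ Fintype.card F ^ s + y ^ Fintype.card F ^ (3 * s)] : Fin 4 → K) =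
      ![x, y, σ (σ x) + σ y, σ x + σ (σ (σ y))] := by
    intro x y
    simp only [hσx, hpp]
    rw [show s + s = 2 * s by ring, show 2 * s + s = 3 * s by ring]
  change (∃ x y : K, _) ↔ _
  simp only [htr, hv]

/-- A functional with small values on `exampleFour` would give a three-dimensional subspace with all
the vectors of `FunctionalVectors` in its graph span. -/
theorem minRank_exampleFour [FiniteDimensional F K] {h : ℕ} (hh : Odd h)
    (hF : Fintype.card F = 2 ^ h) (hK : finrank F K = 6) {s : ℕ} (hs : s = 1 ∨ s = 5) :
    MinRank (K := K) 4 (exampleFour F K s) := by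
  obtain ⟨σ, hσ, hσx⟩ := exists_frobenius_pow (F := F) (K := K) s
  obtain ⟨E, ω, θ, H⟩ := exists_sexticData hh hF hK
    (by rcases hs with rfl | rfl <;> norm_num) hσ hσx
  intro φ hφ
  by_contra hlt
  push Not at hlt
  set T := (exampleFour F K s).map (φ.restrictScalars F) with hT
  let c : Fin 4 → K := fun i => φ (Pi.single i 1)
  have hφc : ∀ v, φ v = ∑ i, c i * v i := functional_eq_sum φ
  have hmem : ∀ x y : K, x + σ (σ x) + σ (σ (σ (σ x))) = 0 →
      y + σ (σ y) + σ (σ (σ (σ y))) = 0 →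
      c 0 * x + c 1 * y + c 2 * (σ (σ x) + σ y) + c 3 * (σ x + σ (σ (σ y))) ∈ T := by
    intro x y hx hy
    refine ⟨_, (mem_exampleFour_iff hK hs hσx _).2 ⟨x, y, hx, hy, rfl⟩, ?_⟩
    change φ _ = _
    rw [hφc, Fin.sum_univ_four]
    rfl
  obtain ⟨h0, h1, h2, h3⟩ := H.coeff_eq_zero (H.functionalVectors hmem)
    ((finrank_graphSpan_le σ E T).trans (by omega))
  apply hφ
  refine LinearMap.ext fun v => ?_
  rw [hφc, Fin.sum_univ_four, h0, h1, h2, h3]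
  simp

theorem finrank_exampleFour [FiniteDimensional F K] {h : ℕ} (hh : Odd h)
    (hF : Fintype.card F = 2 ^ h) (hK : finrank F K = 6) {s : ℕ} (hs : s = 1 ∨ s = 5) :
    finrank F (exampleFour F K s) = 8 := by
  obtain ⟨σ, hσ, hσx⟩ := exists_frobenius_pow (F := F) (K := K) s
  obtain ⟨E, ω, θ, H⟩ := exists_sexticData hh hF hK
    (by rcases hs with rfl | rfl <;> norm_num) hσ hσx
  have hE : finrank F E = 2 := by
    have h1 := finrank_mul_finrank F E K
    rw [H.finrank_eq, hK] at h1
    omega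
  let S : K →ₗ[F] K := σ.toLinearMap
  let L : K →ₗ[F] K := LinearMap.id + S ∘ₗ S + S ∘ₗ S ∘ₗ S ∘ₗ S
  have hL : ∀ x, L x = x + σ (σ x) + σ (σ (σ (σ x))) := fun x => rfl
  have h6 : ∀ x, σ (σ (σ (σ (σ (σ x))))) = x := by
    have : Finite K := Module.finite_of_finite F
    have : Fintype K := Fintype.ofFinite K
    intro x
    simp only [hσx, ← pow_mul, ← pow_add]
    rw [show s + s + s + s + s + s = 6 * s by ring, pow_mul, ← hK,
      ← Module.card_eq_pow_finrank (K := F) (V := K), FiniteField.pow_card_pow]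
  -- the trace map to `E` is onto, as it is multiplication by `3 = 1` on `E`
  have hrange : LinearMap.range L = E.toSubmodule := by
    ext e
    constructor
    · rintro ⟨x, rfl⟩
      change L x ∈ E
      rw [H.mem_iff, hL]
      simp only [map_add, h6]
      ring
    · intro he
      have he' := (H.mem_iff e).1 he
      refine ⟨e, ?_⟩
      rw [hL, he', he']
      linear_combination e * H.two
  have hker : finrank F (LinearMap.ker L) = 4 := by
    have h1 := LinearMap.finrank_range_add_finrank_ker L
    rw [hrange, hK] at h1
    have h2 : finrank F E.toSubmodule = 2 := hE
    omega
  let W := LinearMap.ker L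
  let g : (W × W) →ₗ[F] (Fin 4 → K) := LinearMap.pi
    ![W.subtype ∘ₗ LinearMap.fst F W W, W.subtype ∘ₗ LinearMap.snd F W W,
      S ∘ₗ S ∘ₗ W.subtype ∘ₗ LinearMap.fst F W W + S ∘ₗ W.subtype ∘ₗ LinearMap.snd F W W,
      S ∘ₗ W.subtype ∘ₗ LinearMap.fst F W W + S ∘ₗ S ∘ₗ S ∘ₗ W.subtype ∘ₗ LinearMap.snd F W W]
  have hg : ∀ p : W × W, g p = ![(p.1 : K), p.2, σ (σ p.1) + σ p.2, σ p.1 + σ (σ (σ p.2))] := by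
    intro p
    ext i
    fin_cases i <;> rfl
  have hgU : LinearMap.range g = exampleFour F K s := by
    ext v
    rw [mem_exampleFour_iff hK hs hσx]
    constructor
    · rintro ⟨p, rfl⟩
      exact ⟨p.1, p.2, p.1.2, p.2.2, hg p⟩
    · rintro ⟨x, y, hx, hy, rfl⟩
      exact ⟨(⟨x, hx⟩, ⟨y, hy⟩), hg _⟩
  have hinj : Function.Injective g := by
    intro p p' hp
    have h1 := congrFun hp 0
    have h2 := congrFun hp 1
    exact Prod.ext (Subtype.ext h1) (Subtype.ext h2)
  rw [← hgU, LinearMap.finrank_range_of_inj hinj, finrank_prod, hker]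

end Examples

/-! ### Maximum two-scattered subspaces -/

section Maximum

variable {F K : Type*} [Field F] [Fintype F] [Field K] [Algebra F K] [FiniteDimensional F K]

theorem isMaxScattered_exampleThree (hK : finrank F K = 6) :
    IsMaxScattered K 2 (exampleThree F K) :=
  isMaxScattered_of_minRank hK (by simp) (minRank_exampleThree (by omega))
    (by rw [finrank_exampleThree, hK]; simp)

/-- Direct sums of maximum examples in dimension three and of the examples `U_s` in dimension four
are maximum, because the bound on the values of functionals passes to direct sums. -/
theorem isMaxScattered_directSum {h : ℕ} (hh : Odd h) (hF : Fintype.card F = 2 ^ h)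
    (hK : finrank F K = 6) {r a b : ℕ} (hr : 3 ≤ r) (hab : 3 * a + 4 * b = r)
    (A : Fin a → Submodule F (Fin 3 → K)) (s : Fin b → ℕ) (hA : ∀ i, IsMaxScattered K 2 (A i))
    (hs : ∀ j, 1 ≤ s j ∧ s j ≤ 5 ∧ Nat.gcd (s j) 6 = 1)
    (e : ((Fin a → Fin 3 → K) × (Fin b → Fin 4 → K)) ≃ₗ[K] (Fin r → K)) :
    IsMaxScattered K 2 ((directSum A fun j => exampleFour F K (s j)).map
      (e.toLinearMap.restrictScalars F)) ∧
    finrank F ((directSum A fun j => exampleFour F K (s j)).map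
      (e.toLinearMap.restrictScalars F)) = 2 * r := by
  have hs' : ∀ j, s j = 1 ∨ s j = 5 := by
    intro j
    obtain ⟨h1, h2, h3⟩ := hs j
    generalize s j = t at h1 h2 h3
    interval_cases t <;> simp_all
  have hdimA : ∀ i, finrank F (A i) = 6 := by
    intro i
    have h1 := (isMaxScattered_exampleThree hK).finrank_eq
      (by rw [finrank_exampleThree, hK]; simp) (hA i)
    simpa using h1
  have hdim : finrank F ((directSum A fun j => exampleFour F K (s j)).map
      (e.toLinearMap.restrictScalars F)) = 2 * r := by
    rw [finrank_map_equiv, directSum, finrank_submodule_prod, finrank_submodule_pi,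
      finrank_submodule_pi]
    simp only [hdimA, finrank_exampleFour hh hF hK (hs' _), Finset.sum_const, Finset.card_univ,
      Fintype.card_fin, smul_eq_mul]
    omega
  refine ⟨isMaxScattered_of_minRank hK (by simpa using hr) ?_ (by simpa using hdim), hdim⟩
  refine MinRank.map_equiv (MinRank.prod (MinRank.pi fun i => ?_) (MinRank.pi fun j => ?_)) e
  · exact (hA i).1.minRank hK (by rw [hdimA]; simp)
  · exact minRank_exampleFour hh hF hK (hs' j)

theorem exists_isMaxScattered {h : ℕ} (hh : Odd h) (hF : Fintype.card F = 2 ^ h)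
    (hK : finrank F K = 6) {r : ℕ} (hr : 3 ≤ r) (hr5 : r ≠ 5) :
    ∃ U : Submodule F (Fin r → K), IsMaxScattered K 2 U ∧ finrank F U = 2 * r := by
  -- `4 * (r % 3) ≤ r` as `r` is none of `1`, `2` and `5`
  obtain ⟨a, b, hab⟩ : ∃ a b : ℕ, 3 * a + 4 * b = r :=
    ⟨(r - 4 * (r % 3)) / 3, r % 3, by omega⟩
  have hdim : finrank K ((Fin a → Fin 3 → K) × (Fin b → Fin 4 → K)) = finrank K (Fin r → K) := by
    simp [finrank_prod, finrank_pi_fintype]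
    omega
  exact ⟨_, isMaxScattered_directSum hh hF hK hr hab (fun _ => exampleThree F K) (fun _ => 1)
    (fun _ => isMaxScattered_exampleThree hK) (fun _ => by norm_num)
    (LinearEquiv.ofFinrankEq _ _ hdim)⟩

end Maximum

end Scattered

end

theorem mainTheorem2 {F K : Type*} [Field F] [Fintype F] [Field K] [Algebra F K]
    (h : ℕ) (hh : Odd h) (hF : Fintype.card F = 2 ^ h) (hK : Module.finrank F K = 6)
    (r : ℕ) (hr : 3 ≤ r) (hr5 : r ≠ 5) :
    -- existence of maximum 2-scattered subspaces in `V(r, q ^ 6)`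
    (∃ U : Submodule F (Fin r → K), Scattered.IsMaxScattered K 2 U) ∧
    -- `r` is a sum of threes and fours, and there are 3-dimensional examples
    (∃ a b : ℕ, 3 * a + 4 * b = r) ∧
    (∃ A : Submodule F (Fin 3 → K), Scattered.IsMaxScattered K 2 A) ∧
    -- direct sums of maximum examples in dimension 3 and of the examples `U_s` in dimension 4
    (∀ (a b : ℕ), 3 * a + 4 * b = r →
      ∀ (A : Fin a → Submodule F (Fin 3 → K)) (s : Fin b → ℕ),
        (∀ i, Scattered.IsMaxScattered K 2 (A i)) →
        (∀ j, 1 ≤ s j ∧ s j ≤ 5 ∧ Nat.gcd (s j) 6 = 1) →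
        ∀ e : ((Fin a → Fin 3 → K) × (Fin b → Fin 4 → K)) ≃ₗ[K] (Fin r → K),
          Scattered.IsMaxScattered K 2
            ((Scattered.directSum A fun j => Scattered.exampleFour F K (s j)).map
              (e.toLinearMap.restrictScalars F))) ∧
    -- the dimension of every maximum 2-scattered subspace, and the associated codes
    (∀ U : Submodule F (Fin r → K), Scattered.IsMaxScattered K 2 U →
      Module.finrank F U = 2 * r ∧
      (∃ C : Submodule K (Fin (2 * r) → K), Scattered.IsAssociated U C) ∧
      ∀ C : Submodule K (Fin (2 * r) → K), Scattered.IsAssociated U C →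
        Scattered.IsCode F (2 * r) r 4 C ∧
        Scattered.IsMRD F C ∧
        Scattered.HasGenRankWeight F C (r - 2) (2 * r - 2) ∧
        Scattered.IsRhoMRD F (r - 2) C ∧
        (r ≠ 3 → ¬ Scattered.IsRhoMRD F 1 C)) := by
  have : FiniteDimensional F K := Module.finite_of_finrank_eq_succ hK
  obtain ⟨U₀, hU₀, hdim₀⟩ := Scattered.exists_isMaxScattered (K := K) hh hF hK hr hr5
  refine ⟨⟨U₀, hU₀⟩, ⟨(r - 4 * (r % 3)) / 3, r % 3, by omega⟩,
    ⟨_, Scattered.isMaxScattered_exampleThree hK⟩, ?_, fun U hU => ?_⟩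
  · intro a b hab A s hA hs e
    exact (Scattered.isMaxScattered_directSum hh hF hK hr hab A s hA hs e).1
  have hdim : Module.finrank F U = 2 * r := by
    simpa using hU₀.finrank_eq (by simpa using hdim₀) hU
  refine ⟨hdim, Scattered.exists_isAssociated hU.1.2.2.1 hdim, fun C hC => ?_⟩
  have hgen := hU.1.hasGenRankWeight hdim hC
  refine ⟨⟨hC.finrank_eq, hU.1.isMinDist hK hdim hC⟩, hU.1.isMRD hK hdim hC, hgen,
    ⟨by omega, ?_⟩, hU.1.not_isRhoMRD_one hK hdim hC⟩
  rw [hC.finrank_eq]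
  convert hgen using 1
  omega
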